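/- Let $R$ be a commutative noetherian ring, let $\mathscr{S}$ be a Serre subcategory of the category of $R$-modules (a non-empty class of modules closed under submodules, quotient modules and extensions), and let $\mathscr{L}$ be a localizing subcategory (a Serre subcategory closed under arbitrary direct sums). For a prime ideal $\mathfrak{p}$ write $k(\mathfrak{p}) = R_{\mathfrak{p}}/\mathfrak{p}R_{\mathfrak{p}}$. For every ideal $I$ of $R$ choose an arbitrary finite system of generators $I=(x_1,\dots,x_n)$, let $K(I)$ be the Koszul complex of $x_1,\dots,x_n$, and for an $R$-module $M$ put $H_i(K(I),M) = H_i(K(I)\otimes_R M)$ and $H^i(K(I),M) = H^i(\operatorname{Hom}_R(K(I),M))$. Then, for every $R$-module $M$ (and every such choice of generators), the following assertions are equivalent: 1. $\operatorname{Tor}_i^R(k(\mathfrak{p}),M)\in\mathscr{L}$ for every prime ideal $\mathfrak{p}$ with $R/\mathfrak{p}\in\mathscr{S}$ and every $i\ge 0$. 2. $\operatorname{Tor}_i^R(S,M)\in\mathscr{L}$ for every $S\in\mathscr{S}$ and every $i\ge 0$. 3. $\operatorname{Tor}_i^R(R/I,M)\in\mathscr{L}$ for every ideal $I$ with $R/I\in\mathscr{S}$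 and every $i\ge 0$. 4. $H_i(K(I),M)\in\mathscr{L}$ for every ideal $I$ with $R/I\in\mathscr{S}$ and every $i\ge 0$. 5. $\operatorname{Ext}^i_R(R/I,M)\in\mathscr{L}$ for every ideal $I$ with $R/I\in\mathscr{S}$ and every $i\ge 0$. 6. $H^i(K(I),M)\in\mathscr{L}$ for every ideal $I$ with $R/I\in\mathscr{S}$ and every $i\ge 0$. -/

import Mathlib

open CategoryTheory

universe u

/-- A localizing subcategory of `Mod R`: a Serre subcategory (non-empty and closed under
submodules, quotients and extensions) closed under arbitrary direct sums. -/
class IsLocalizingSubcategory {R : Type u} [CommRing R]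
    (L : ObjectProperty (ModuleCat.{u} R)) : Prop extends L.IsSerreClass where
  directSum_mem : ∀ (J : Type u) (X : J → ModuleCat.{u} R), (∀ j, L (X j)) →
    L (ModuleCat.of R (DirectSum J fun j => X j))

noncomputable section

namespace Koszul

variable {R : Type u} [CommRing R] {n : ℕ}

/-- The `p`-element subsets of `{0, …, n - 1}`. -/
abbrev Idx (n p : ℕ) : Type := {s : Finset (Fin n) // s.card = p}

/-- The subset `t ∪ {i}`, for `i ∉ t`. -/
def Idx.insert {p : ℕ} (t : Idx n p) (i : Fin n) (hi : i ∉ t.1) : Idx n (p + 1) :=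
  ⟨Insert.insert i t.1, by rw [Finset.card_insert_of_notMem hi, t.2]⟩

/-- The sign `(-1) ^ #{j ∈ t | j < i}`. -/
def sign (R : Type u) [CommRing R] (t : Finset (Fin n)) (i : Fin n) : R :=
  (-1) ^ (t.filter (· < i)).card

/-- The Koszul differential `⋀^(p+1) R^n → ⋀^p R^n`. The module `⋀^p R^n` is the free module with
basis `e_s` for the `p`-element subsets `s` of `Fin n`, an element being identified with its family
of coordinates, and the differential is
`e_s ↦ ∑ i ∈ s, (-1) ^ #{j ∈ s | j < i} • x i • e_(s \ {i})`. Thus the coordinate at `t` of the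
image of `f` is the sum over `i ∉ t` of `(-1) ^ #{j ∈ t | j < i} * x i * f (t ∪ {i})`. -/
def d (x : Fin n → R) (p : ℕ) : (Idx n (p + 1) → R) →ₗ[R] (Idx n p → R) where
  toFun f t := ∑ i : Fin n,
    if hi : i ∉ t.1 then sign R t.1 i * x i * f (t.insert i hi) else 0
  map_add' f g := by
    ext t
    simp only [Pi.add_apply, ← Finset.sum_add_distrib]
    refine Finset.sum_congr rfl fun i _ => ?_
    split_ifs <;> simp [mul_add]
  map_smul' r f := by
    ext t
    simp only [Pi.smul_apply, smul_eq_mul, RingHom.id_apply, Finset.mul_sum]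
    refine Finset.sum_congr rfl fun i _ => ?_
    split_ifs <;> ring

lemma sign_insert_of_lt {t : Finset (Fin n)} {i j : Fin n} (hi : i ∉ t) (h : i < j) :
    sign R (Insert.insert i t) j = - sign R t j := by
  have : i ∉ t.filter (· < j) := fun hh => hi (Finset.mem_filter.1 hh).1
  rw [sign, sign, Finset.filter_insert, if_pos h, Finset.card_insert_of_notMem this, pow_succ]
  ring

lemma sign_insert_of_gt {t : Finset (Fin n)} {i j : Fin n} (h : j < i) :
    sign R (Insert.insert i t) j = sign R t j := by
  rw [sign, sign, Finset.filter_insert, if_neg (not_lt.2 h.le)]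

lemma sign_antisymm {t : Finset (Fin n)} {i j : Fin n} (hi : i ∉ t) (hj : j ∉ t) (hij : i ≠ j) :
    sign R t i * sign R (Insert.insert i t) j = - (sign R t j * sign R (Insert.insert j t) i) := by
  rcases lt_or_gt_of_ne hij with h | h
  · rw [sign_insert_of_lt hi h, sign_insert_of_gt h]; ring
  · rw [sign_insert_of_gt h, sign_insert_of_lt hj h]; ring

lemma d_comp_d (x : Fin n → R) (p : ℕ) : d x p ∘ₗ d x (p + 1) = 0 := by
  refine LinearMap.ext fun f => funext fun t => ?_
  let T : Fin n × Fin n → R := fun q =>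
    if hi : q.1 ∉ t.1 then
      if hj : q.2 ∉ (t.insert q.1 hi).1 then
        sign R t.1 q.1 * x q.1 * (sign R (t.insert q.1 hi).1 q.2 * x q.2 *
          f ((t.insert q.1 hi).insert q.2 hj))
      else 0
    else 0
  have key : (d x p (d x (p + 1) f)) t = ∑ q : Fin n × Fin n, T q := by
    rw [Fintype.sum_prod_type]
    change (∑ i : Fin n, if hi : i ∉ t.1 then
      sign R t.1 i * x i * d x (p + 1) f (t.insert i hi) else 0) = _
    refine Finset.sum_congr rfl fun i _ => ?_
    by_cases hi : i ∉ t.1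
    · simp only [T, dif_pos hi]
      change _ * (∑ j : Fin n, (if hj : j ∉ (t.insert i hi).1 then
        sign R (t.insert i hi).1 j * x j * f ((t.insert i hi).insert j hj) else 0)) = _
      rw [Finset.mul_sum]
      refine Finset.sum_congr rfl fun j _ => ?_
      split_ifs <;> simp
    · simp [T, hi]
  have anti : ∀ i j : Fin n, T (i, j) + T (j, i) = 0 := by
    intro i j
    by_cases hi : i ∈ t.1
    · simp [T, hi, Idx.insert]
    by_cases hj : j ∈ t.1
    · simp [T, hj, Idx.insert]
    by_cases hij : i = j
    · subst hij
      simp [T, Idx.insert]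
    have h1 : j ∉ (t.insert i hi).1 := by simp [Idx.insert, hj, Ne.symm hij]
    have h2 : i ∉ (t.insert j hj).1 := by simp [Idx.insert, hi, hij]
    have e : (t.insert i hi).insert j h1 = (t.insert j hj).insert i h2 :=
      Subtype.ext (Finset.insert_comm j i t.1)
    have hs := sign_antisymm (R := R) hi hj hij
    simp only [T, dif_pos hi, dif_pos hj, dif_pos h1, dif_pos h2, e]
    change _ * (sign R (Insert.insert i t.1) j * _ * _) +
      _ * (sign R (Insert.insert j t.1) i * _ * _) = 0
    linear_combination (x i * x j * f ((t.insert j hj).insert i h2)) * hs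
  change (d x p (d x (p + 1) f)) t = 0
  rw [key]
  refine Finset.sum_involution (fun q _ => (q.2, q.1)) (fun q _ => anti q.1 q.2) ?_
    (fun _ _ => Finset.mem_univ _) (fun _ _ => rfl)
  rintro ⟨i, j⟩ - hne heq
  apply hne
  have : j = i := congrArg Prod.fst heq
  subst this
  simp [T, Idx.insert]

/-- The Koszul complex `K(x)` of a finite sequence `x` of elements of `R`. -/
def complex (x : Fin n → R) : ChainComplex (ModuleCat.{u} R) ℕ :=
  ChainComplex.of (fun p => ModuleCat.of R (Idx n p → R)) (fun p => ModuleCat.ofHom (d x p))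
    (fun p => by rw [← ModuleCat.ofHom_comp, d_comp_d]; rfl)

/-- Koszul homology `H_i(K(x), M) = H_i(K(x) ⊗ M)`. -/
def homology (x : Fin n → R) (M : ModuleCat.{u} R) (i : ℕ) : ModuleCat.{u} R :=
  (((MonoidalCategory.tensorRight M).mapHomologicalComplex (ComplexShape.down ℕ)).obj
    (complex x)).homology i

/-- Koszul cohomology `H^i(K(x), M) = H^i(Hom(K(x), M))`. -/
def cohomology (x : Fin n → R) (M : ModuleCat.{u} R) (i : ℕ) : ModuleCat.{u} R :=
  ((complex x).linearYonedaObj R M).homology i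

end Koszul

end

/-! ### Serre classes and finitely generated modules -/

section SerreBasics

variable {R : Type u} [CommRing R] (S : ObjectProperty (ModuleCat.{u} R)) [S.IsSerreClass]

/-! Call an ideal J dense when R/J lies in `L`. Because `L` is closed under direct sums, a module
lies in `L` exactly when each of its elements is killed by a dense ideal (`localizing_iff`).
Membership of a homology module in `L` thus becomes a statement about cycles and boundaries, and
diagram chases go through up to multiplication by dense ideals (`isTorsionMod_of_smul`).

For fixed M, the classes of N with Tor_j(N, M) in `L` and those with Ext^j(N, M) in `L` obey the
same rules on short exact sequences. `IsDeltaClass` records these rules, so that one argument serves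
both functors. A finitely generated module in `S` is filtered by quotients R/q in `S` with q prime,
and Tor commutes with directed unions; hence Tor on all of `S` is controlled by the prime quotients.
These are exchanged with the residue fields by Noetherian induction
(`torClass_prime_of_residueField`): the finitely generated submodules of k(p)/(R/p) only involve
primes strictly above p.

For the Koszul complex K of I, the homology is finitely generated and killed by I, with H_0 = R/I.
Write Q_q for the cokernel of K_{q+1} → K_q and B_q for its image in K_q. The sequences 0 → H_{q+1}
→ Q_{q+1} → B_q → 0 and 0 → B_q → K_q → Q_q → 0 allow dimension shifting. If all H_i(K, M) lie in
`L`, then so do the Tor_1(Q_q, M), and induction on i reaches Tor_i(R/I, M). Conversely, Tor of the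
modules H_q yields Tor_1(Q_q, M), and from it H_{q+1}(K, M). The same holds for Ext and Koszul
cohomology.

Finally K is self-dual, H_p(K, M) corresponding to H^{n-p}(K, M), which joins the Tor conditions to
the Ext conditions. -/

lemma serre_of_injective {A B : Type u} [AddCommGroup A] [Module R A] [AddCommGroup B] [Module R B]
    (f : A →ₗ[R] B) (hf : Function.Injective f) (hB : S (ModuleCat.of R B)) :
    S (ModuleCat.of R A) := by
  have : Mono (ModuleCat.ofHom f) := (ModuleCat.mono_iff_injective _).2 hf
  exact S.prop_of_mono (ModuleCat.ofHom f) hB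

lemma serre_of_surjective {A B : Type u} [AddCommGroup A] [Module R A] [AddCommGroup B]
    [Module R B] (f : A →ₗ[R] B) (hf : Function.Surjective f) (hA : S (ModuleCat.of R A)) :
    S (ModuleCat.of R B) := by
  have : Epi (ModuleCat.ofHom f) := (ModuleCat.epi_iff_surjective _).2 hf
  exact S.prop_of_epi (ModuleCat.ofHom f) hA

lemma serre_of_exact {A B C : Type u} [AddCommGroup A] [Module R A] [AddCommGroup B]
    [Module R B] [AddCommGroup C] [Module R C] (f : A →ₗ[R] B) (g : B →ₗ[R] C)
    (h : Function.Exact f g) (hA : S (ModuleCat.of R A)) (hC : S (ModuleCat.of R C)) :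
    S (ModuleCat.of R B) := by
  have := ModuleCat.shortComplex_exact (ShortComplex.moduleCatMk f g h.linearMap_comp_eq_zero) h
  exact S.prop_X₂_of_exact this hA hC

lemma serre_of_subsingleton {A : Type u} [AddCommGroup A] [Module R A] [Subsingleton A] :
    S (ModuleCat.of R A) :=
  S.prop_of_isZero (ModuleCat.isZero_of_subsingleton _)

lemma serre_of_linearEquiv {A B : Type u} [AddCommGroup A] [Module R A] [AddCommGroup B]
    [Module R B] (e : A ≃ₗ[R] B) (hA : S (ModuleCat.of R A)) : S (ModuleCat.of R B) :=
  serre_of_surjective S e.toLinearMap e.surjective hA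

lemma serre_quotient_of_le {I J : Ideal R} (h : I ≤ J) (hI : S (ModuleCat.of R (R ⧸ I))) :
    S (ModuleCat.of R (R ⧸ J)) :=
  serre_of_surjective S (Submodule.factor h) (Submodule.factor_surjective h) hI

lemma exact_single_funLeft_succ {R A : Type*} [CommRing R] [AddCommGroup A] [Module R A] (n : ℕ) :
    Function.Exact (LinearMap.single R (fun _ : Fin (n + 1) => A) 0)
      (LinearMap.funLeft R A (Fin.succ : Fin n → Fin (n + 1))) := by
  intro z
  constructor
  · intro hz
    refine ⟨z 0, funext fun i => ?_⟩
    refine Fin.cases (by simp) (fun i => ?_) i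
    have := congrFun hz i
    simpa [LinearMap.funLeft_apply] using this.symm
  · rintro ⟨a, rfl⟩
    ext i
    simp [LinearMap.funLeft_apply]

lemma serre_pow {A : Type u} [AddCommGroup A] [Module R A] (hA : S (ModuleCat.of R A)) (n : ℕ) :
    S (ModuleCat.of R (Fin n → A)) := by
  induction n with
  | zero => exact serre_of_subsingleton S
  | succ n ih => exact serre_of_exact S _ _ (exact_single_funLeft_succ n) hA ih

/-- A finitely generated module killed by `I` is a quotient of some `(R ⧸ I)^n`. -/
lemma exists_pow_quotient_surjective {R : Type u} [CommRing R] {I : Ideal R} {A : Type u}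
    [AddCommGroup A] [Module R A] [Module.Finite R A] (hA : I ≤ Module.annihilator R A) :
    ∃ (n : ℕ) (f : (Fin n → R ⧸ I) →ₗ[R] A), Function.Surjective f := by
  obtain ⟨n, s, hs⟩ := Module.Finite.exists_fin (R := R) (M := A)
  refine ⟨n, LinearMap.lsum R (fun _ => R ⧸ I) R fun i =>
    I.liftQ (LinearMap.toSpanSingleton R A (s i)) fun a ha => ?_, ?_⟩
  · simpa using Module.mem_annihilator.1 (hA ha) (s i)
  · rw [← LinearMap.range_eq_top, eq_top_iff, ← hs, Submodule.span_le]
    rintro _ ⟨i, rfl⟩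
    refine ⟨Pi.single i (Submodule.Quotient.mk 1), ?_⟩
    rw [LinearMap.lsum_apply]
    simp only [LinearMap.coe_sum, Finset.sum_apply, LinearMap.comp_apply, LinearMap.proj_apply]
    rw [Finset.sum_eq_single i]
    · rw [Pi.single_eq_same, Submodule.liftQ_apply, LinearMap.toSpanSingleton_apply, one_smul]
    · intro j _ hj
      simp [Pi.single_eq_of_ne hj]
    · simp

/-- A finitely generated module killed by `I` is in a Serre class containing `R ⧸ I`. -/
lemma serre_of_finite {I : Ideal R} (hI : S (ModuleCat.of R (R ⧸ I)))
    {A : Type u} [AddCommGroup A] [Module R A] [Module.Finite R A]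
    (hA : I ≤ Module.annihilator R A) : S (ModuleCat.of R A) := by
  obtain ⟨n, f, hf⟩ := exists_pow_quotient_surjective hA
  exact serre_of_surjective S f hf (serre_pow S hI n)

end SerreBasics

/-! ### Localizing subcategories through torsion elements -/

section Torsion

variable {R : Type u} [CommRing R] (L : ObjectProperty (ModuleCat.{u} R))

/-- The class of `z` in the quotient by `U` is killed by an ideal `J` with `R ⧸ J` in `L`. -/
def IsTorsionMod {N : Type*} [AddCommGroup N] [Module R N] (U : Submodule R N) (z : N) : Prop :=
  ∃ J : Ideal R, L (ModuleCat.of R (R ⧸ J)) ∧ ∀ a ∈ J, a • z ∈ U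

variable {L} {N : Type*} [AddCommGroup N] [Module R N]

lemma IsTorsionMod.map {N' : Type*} [AddCommGroup N'] [Module R N'] {U : Submodule R N}
    {V : Submodule R N'} {z : N} (h : IsTorsionMod L U z) (f : N →ₗ[R] N') (hUV : U ≤ V.comap f) :
    IsTorsionMod L V (f z) := by
  obtain ⟨J, hJ, h⟩ := h
  exact ⟨J, hJ, fun a ha => by simpa using hUV (h a ha)⟩

lemma isTorsionMod_of_mem [L.IsSerreClass] {U : Submodule R N} {z : N} (h : z ∈ U) :
    IsTorsionMod L U z :=
  ⟨⊤, serre_of_subsingleton L, fun a _ => U.smul_mem a h⟩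

variable [IsLocalizingSubcategory L]

/-- The cyclic submodule generated by z is R/ann(z), which embeds in the module; conversely, if each
z is killed by J_z, the module is a quotient of the direct sum of the R/J_z. This is where closure
under direct sums enters. -/
lemma localizing_iff {N : Type u} [AddCommGroup N] [Module R N] :
    L (ModuleCat.of R N) ↔ ∀ z : N, IsTorsionMod L ⊥ z := by
  classical
  constructor
  · intro h z
    refine ⟨LinearMap.ker (LinearMap.toSpanSingleton R N z), ?_, fun a ha => by simpa using ha⟩
    exact serre_of_injective L (Submodule.liftQ _ (LinearMap.toSpanSingleton R N z) le_rfl)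
      (LinearMap.ker_eq_bot.1 (Submodule.ker_liftQ_eq_bot _ _ _ le_rfl)) h
  · intro h
    choose J hJ h using h
    refine serre_of_surjective L (DirectSum.toModule R N N fun z =>
      (J z).liftQ (LinearMap.toSpanSingleton R N z) fun a ha => by simpa using h z a ha) ?_
      (IsLocalizingSubcategory.directSum_mem N (fun z => ModuleCat.of R (R ⧸ J z)) hJ)
    intro z
    refine ⟨DirectSum.lof R N (fun z => R ⧸ J z) z (Submodule.Quotient.mk 1), ?_⟩
    rw [DirectSum.toModule_lof, Submodule.liftQ_apply, LinearMap.toSpanSingleton_apply, one_smul]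

lemma localizing_quotient_iff {N : Type u} [AddCommGroup N] [Module R N] {U : Submodule R N} :
    L (ModuleCat.of R (N ⧸ U)) ↔ ∀ z : N, IsTorsionMod L U z := by
  rw [localizing_iff (L := L), (Submodule.mkQ_surjective U).forall]
  refine forall_congr' fun z => ?_
  simp only [IsTorsionMod, Submodule.mem_bot, Submodule.mkQ_apply,
    ← Submodule.Quotient.mk_smul, Submodule.Quotient.mk_eq_zero]

/-- Closure under extensions, as the transitivity axiom of a Gabriel topology: with T = (U : z), the
module R/T is an extension of R/(T + J) by (T + J)/T, and the latter is torsion by hypothesis. It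
lets a chase pick a new ideal for each multiple a • z. -/
lemma isTorsionMod_of_smul {U : Submodule R N} {z : N} {J : Ideal R}
    (hJ : L (ModuleCat.of R (R ⧸ J))) (h : ∀ a ∈ J, IsTorsionMod L U (a • z)) :
    IsTorsionMod L U z := by
  set T : Ideal R := U.comap (LinearMap.toSpanSingleton R N z) with hT
  refine ⟨T, ?_, fun a ha => by simpa [hT] using ha⟩
  have key : Function.Exact (Submodule.subtype (Submodule.map T.mkQ J))
      (Submodule.factor (le_sup_left : T ≤ T ⊔ J)) := by
    rw [LinearMap.exact_iff, Submodule.range_subtype]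
    ext y
    obtain ⟨y, rfl⟩ := Submodule.mkQ_surjective T y
    rw [LinearMap.mem_ker, Submodule.factor_mk, ← LinearMap.mem_ker, Submodule.ker_mkQ,
      ← Submodule.mem_comap (f := T.mkQ), Submodule.comap_map_mkQ]
  refine serre_of_exact L _ _ key ?_ (serre_quotient_of_le L le_sup_right hJ)
  rw [localizing_iff (L := L)]
  rintro ⟨_, a, ha, rfl⟩
  obtain ⟨J', hJ', h'⟩ := h a ha
  refine ⟨J', hJ', fun b hb => ?_⟩
  have := h' b hb
  rw [Submodule.mem_bot]
  apply Subtype.ext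
  rw [Submodule.coe_smul, ← map_smul]
  simp only [Submodule.mkQ_apply, ZeroMemClass.coe_zero, Submodule.Quotient.mk_eq_zero, hT,
    Submodule.mem_comap, LinearMap.toSpanSingleton_apply, smul_assoc]
  exact this

lemma IsTorsionMod.trans {U V : Submodule R N} {z : N} (h : IsTorsionMod L U z)
    (hUV : ∀ y ∈ U, IsTorsionMod L V y) : IsTorsionMod L V z := by
  obtain ⟨J, hJ, h⟩ := h
  exact isTorsionMod_of_smul hJ fun a ha => hUV _ (h a ha)

lemma IsTorsionMod.add {U : Submodule R N} {z w : N} (hz : IsTorsionMod L U z)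
    (hw : IsTorsionMod L U w) : IsTorsionMod L U (z + w) := by
  obtain ⟨J, hJ, h⟩ := hz
  refine isTorsionMod_of_smul hJ fun a ha => ?_
  obtain ⟨J', hJ', hw⟩ := hw
  refine ⟨J', hJ', fun b hb => ?_⟩
  rw [smul_add, smul_add]
  refine U.add_mem (U.smul_mem _ (h a ha)) ?_
  rw [smul_comm]
  exact U.smul_mem _ (hw b hb)

/-- The homology of a complex lies in a localizing subcategory if and only if each cycle is
torsion modulo the boundaries. -/
lemma localizing_homology_iff {ι : Type*} {c : ComplexShape ι}
    (K : HomologicalComplex (ModuleCat.{u} R) c) (i : ι) :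
    L (K.homology i) ↔ ∀ z : K.X i, (∀ j, (K.d i j).hom z = 0) →
      IsTorsionMod L (LinearMap.range (K.d (c.prev i) i).hom) z := by
  have hcyc (z : K.X i) : (∀ j, (K.d i j).hom z = 0) ↔ (K.d i (c.next i)).hom z = 0 := by
    refine ⟨fun h => h _, fun h j => ?_⟩
    by_cases hij : c.Rel i j
    · obtain rfl := c.next_eq' hij
      exact h
    · rw [K.shape _ _ hij]; rfl
  have h1 : L (K.homology i) ↔ L (K.sc i).moduleCatLeftHomologyData.H :=
    L.prop_iff_of_iso (K.sc i).moduleCatHomologyIso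
  rw [h1]
  change L (ModuleCat.of R (LinearMap.ker (K.sc i).g.hom ⧸
    LinearMap.range (K.sc i).moduleCatToCycles)) ↔ _
  rw [localizing_quotient_iff (L := L)]
  constructor
  · intro h z hz
    refine (h ⟨z, (hcyc z).1 hz⟩).map (Submodule.subtype _) ?_
    rintro _ ⟨w, rfl⟩
    exact ⟨w, rfl⟩
  · rintro h ⟨z, hz⟩
    obtain ⟨J, hJ, h'⟩ := h z ((hcyc z).2 hz)
    refine ⟨J, hJ, fun a ha => ?_⟩
    obtain ⟨w, hw⟩ := h' a ha
    exact ⟨w, Subtype.ext hw⟩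

end Torsion

/-- A family of classes of modules with the formal properties of the family of classes
`{N | Tor_j(N, M) ∈ L}`, or of `{N | Ext^j(N, M) ∈ L}`, for a Serre subcategory `L`. -/
structure IsDeltaClass {R : Type u} [CommRing R] (D : ℕ → ObjectProperty (ModuleCat.{u} R)) :
    Prop where
  subsingleton (j : ℕ) (A : Type u) [AddCommGroup A] [Module R A] [Subsingleton A] :
    D j (ModuleCat.of R A)
  free_succ (j : ℕ) (A : Type u) [AddCommGroup A] [Module R A] [Module.Free R A] :
    D (j + 1) (ModuleCat.of R A)
  mid (j : ℕ) {A B C : Type u} [AddCommGroup A] [Module R A] [AddCommGroup B] [Module R B]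
    [AddCommGroup C] [Module R C] (f : A →ₗ[R] B) (g : B →ₗ[R] C) (hf : Function.Injective f)
    (hg : Function.Surjective g) (h : Function.Exact f g) (hA : D j (ModuleCat.of R A))
    (hC : D j (ModuleCat.of R C)) : D j (ModuleCat.of R B)
  left (j : ℕ) {A B C : Type u} [AddCommGroup A] [Module R A] [AddCommGroup B] [Module R B]
    [AddCommGroup C] [Module R C] (f : A →ₗ[R] B) (g : B →ₗ[R] C) (hf : Function.Injective f)
    (hg : Function.Surjective g) (h : Function.Exact f g) (hB : D j (ModuleCat.of R B))
    (hC : D (j + 1) (ModuleCat.of R C)) : D j (ModuleCat.of R A)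
  right (j : ℕ) {A B C : Type u} [AddCommGroup A] [Module R A] [AddCommGroup B] [Module R B]
    [AddCommGroup C] [Module R C] (f : A →ₗ[R] B) (g : B →ₗ[R] C) (hf : Function.Injective f)
    (hg : Function.Surjective g) (h : Function.Exact f g) (hB : D (j + 1) (ModuleCat.of R B))
    (hA : D j (ModuleCat.of R A)) : D (j + 1) (ModuleCat.of R C)
  right_zero {A B : Type u} [AddCommGroup A] [Module R A] [AddCommGroup B] [Module R B]
    (f : A →ₗ[R] B) (hf : Function.Surjective f) (hA : D 0 (ModuleCat.of R A)) :
    D 0 (ModuleCat.of R B)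

/-! ### Dévissage for delta classes -/

namespace IsDeltaClass

variable {R : Type u} [CommRing R] {D : ℕ → ObjectProperty (ModuleCat.{u} R)}

lemma of_linearEquiv (hD : IsDeltaClass D) (j : ℕ) {A B : Type u} [AddCommGroup A] [Module R A]
    [AddCommGroup B] [Module R B] (e : A ≃ₗ[R] B) (hA : D j (ModuleCat.of R A)) :
    D j (ModuleCat.of R B) :=
  hD.mid j e.toLinearMap (0 : B →ₗ[R] PUnit.{u + 1}) e.injective
    (fun _ => ⟨0, Subsingleton.elim _ _⟩) (fun b => by simp) hA
    (hD.subsingleton j _)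

lemma pow (hD : IsDeltaClass D) (j : ℕ) {A : Type u} [AddCommGroup A] [Module R A]
    (hA : D j (ModuleCat.of R A)) (n : ℕ) : D j (ModuleCat.of R (Fin n → A)) := by
  induction n with
  | zero => exact hD.subsingleton j _
  | succ n ih =>
    exact hD.mid j _ _ (Pi.single_injective (M := fun _ : Fin (n + 1) => A) 0)
      (LinearMap.funLeft_surjective_of_injective R A _ (Fin.succ_injective n))
      (exact_single_funLeft_succ n) hA ih

/-- Dévissage of a finitely generated module killed by `J` into copies of `R ⧸ q`, for the prime
ideals `q` containing `J`. -/
lemma of_finite [IsNoetherianRing R] (hD : IsDeltaClass D) (j : ℕ) {J : Ideal R}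
    (hJ : ∀ q : Ideal R, q.IsPrime → J ≤ q → D j (ModuleCat.of R (R ⧸ q)))
    {N : Type u} [AddCommGroup N] [Module R N] [Module.Finite R N]
    (hN : J ≤ Module.annihilator R N) : D j (ModuleCat.of R N) := by
  revert hN
  induction ‹Module.Finite R N› using
    IsNoetherianRing.induction_on_isQuotientEquivQuotientPrime R with
  | subsingleton N => exact fun _ => hD.subsingleton j N
  | quotient N p e =>
    intro hN
    refine hD.of_linearEquiv j e.symm (hJ p.1 p.2 ?_)
    rwa [e.annihilator_eq, Ideal.annihilator_quotient] at hN
  | exact N₁ N₂ N₃ f g hf hg h h₁ h₃ =>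
    intro hN
    exact hD.mid j f g hf hg h (h₁ (hN.trans (f.annihilator_le_of_injective hf)))
      (h₃ (hN.trans (g.annihilator_le_of_surjective hg)))

/-! ### Dimension shifting along a complex of free modules -/

section Complex

variable {K : ℕ → Type u} [∀ q, AddCommGroup (K q)] [∀ q, Module R (K q)]
  (d : ∀ q, K (q + 1) →ₗ[R] K q) (hd : ∀ q, d q ∘ₗ d (q + 1) = 0)

/-- The map `K_(q+1) / B_(q+1) → B_q` induced by the differential of a complex. -/
def cokerToBoundaries (q : ℕ) :
    (K (q + 1) ⧸ LinearMap.range (d (q + 1))) →ₗ[R] LinearMap.range (d q) :=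
  (LinearMap.range (d (q + 1))).liftQ (d q).rangeRestrict (by
    rintro _ ⟨z, rfl⟩
    exact Subtype.ext (LinearMap.congr_fun (hd q) z))

lemma cokerToBoundaries_surjective (q : ℕ) :
    Function.Surjective (cokerToBoundaries d hd q) := by
  rintro ⟨_, z, rfl⟩
  exact ⟨Submodule.Quotient.mk z, rfl⟩

lemma exact_subtype_ker {A B : Type*} [AddCommGroup A] [Module R A] [AddCommGroup B] [Module R B]
    (f : A →ₗ[R] B) : Function.Exact (LinearMap.ker f).subtype f := by
  rw [LinearMap.exact_iff, Submodule.range_subtype]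

lemma exact_subtype_mkQ {A : Type*} [AddCommGroup A] [Module R A] (U : Submodule R A) :
    Function.Exact U.subtype U.mkQ := by
  rw [LinearMap.exact_iff, Submodule.range_subtype, Submodule.ker_mkQ]

variable [∀ q, Module.Free R (K q)]

/-- If the homology modules of a complex of free modules lie in all classes `D j`, then its
cokernels lie in all classes `D (j + 1)`. -/
lemma coker_of_homology (hD : IsDeltaClass D)
    (h0 : ∀ j, D j (ModuleCat.of R (K 0 ⧸ LinearMap.range (d 0))))
    (hH : ∀ q j, D j (ModuleCat.of R (LinearMap.ker (cokerToBoundaries d hd q)))) (q j : ℕ) :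
    D (j + 1) (ModuleCat.of R (K q ⧸ LinearMap.range (d q))) := by
  induction q generalizing j with
  | zero => exact h0 _
  | succ q ih =>
    -- The cokernel is an extension of the boundaries B_q by the homology; B_q is then the kernel of
    -- K_q → K_q / B_q with K_q free, which costs one degree and calls the induction hypothesis one
    -- step up.
    refine hD.mid _ _ _ (Submodule.subtype_injective _) (cokerToBoundaries_surjective d hd q)
      (exact_subtype_ker _) (hH _ _) ?_
    exact hD.left _ _ _ (Submodule.subtype_injective _) (Submodule.mkQ_surjective _)
      (exact_subtype_mkQ _) (hD.free_succ _ _) (ih _)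

/-- Let `K` be a complex of free modules with `H_0 = R ⧸ I` whose homology modules are finitely
generated and killed by `I`. If its cokernels lie in `D 1`, and `H_0` lies in `D 0`, then all
finitely generated modules killed by `I` lie in all classes `D i`. -/
lemma of_finite_of_coker [IsNoetherianRing R] [∀ q, Module.Finite R (K q)] (hD : IsDeltaClass D)
    {I : Ideal R} (e : (K 0 ⧸ LinearMap.range (d 0)) ≃ₗ[R] R ⧸ I)
    (hI : ∀ q, I ≤ Module.annihilator R (LinearMap.ker (cokerToBoundaries d hd q)))
    (h0 : D 0 (ModuleCat.of R (K 0 ⧸ LinearMap.range (d 0))))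
    (h1 : ∀ q, D 1 (ModuleCat.of R (K q ⧸ LinearMap.range (d q)))) (i : ℕ) :
    ∀ (N : Type u) [AddCommGroup N] [Module R N] [Module.Finite R N],
      I ≤ Module.annihilator R N → D i (ModuleCat.of R N) := by
  induction i using Nat.strong_induction_on with
  | _ i ih =>
  -- Each rise from degree j + 1 to j + 2 for the cokernel at q uses degree j + 1 for the cokernel
  -- at q + 1 and degree j for the homology. The latter is finitely generated and killed by I, so
  -- the outer induction covers it.
  have hQ : ∀ j, j < i → ∀ q, D (j + 1) (ModuleCat.of R (K q ⧸ LinearMap.range (d q))) := by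
    intro j
    induction j with
    | zero => exact fun _ q => h1 q
    | succ j ihj =>
      intro hj q
      refine hD.right _ _ _ (Submodule.subtype_injective _) (Submodule.mkQ_surjective _)
        (exact_subtype_mkQ _) (hD.free_succ _ _) ?_
      exact hD.right _ _ _ (Submodule.subtype_injective _) (cokerToBoundaries_surjective d hd q)
        (exact_subtype_ker _) (ihj (by omega) (q + 1)) (ih j (by omega) _ (hI q))
  -- R/I is the cokernel at q = 0.
  have hRI : D i (ModuleCat.of R (R ⧸ I)) := by
    refine hD.of_linearEquiv i e ?_
    cases i with
    | zero => exact h0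
    | succ i => exact hQ i (by omega) 0
  intro N _ _ _ hN
  obtain ⟨n, f, hf⟩ := exists_pow_quotient_surjective hN
  cases i with
  | zero => exact hD.right_zero f hf (hD.pow 0 hRI n)
  | succ i =>
    -- The kernel of (R/I)^n → N is again finitely generated and killed by I, one degree lower.
    refine hD.right i _ f (Submodule.subtype_injective _) hf (exact_subtype_ker f)
      (hD.pow _ hRI n) (ih i (by omega) _ ?_)
    refine le_trans ?_ (LinearMap.annihilator_le_of_injective _ (LinearMap.ker f).injective_subtype)
    intro a ha
    rw [Module.mem_annihilator]
    intro z
    ext k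
    obtain ⟨y, hy⟩ := Submodule.Quotient.mk_surjective I (z k)
    rw [Pi.smul_apply, Pi.zero_apply, ← hy, ← Submodule.Quotient.mk_smul,
      Submodule.Quotient.mk_eq_zero, smul_eq_mul]
    exact I.mul_mem_right _ ha

end Complex

end IsDeltaClass

/-! ### The classes defined by Tor -/

section TorClass

open TensorProduct

variable {R : Type u} [CommRing R] (L : ObjectProperty (ModuleCat.{u} R))

/-- The modules `N` such that `H_i(N ⊗ P) ∈ L`, in terms of elements. -/
def TensorTorsion (P : ChainComplex (ModuleCat.{u} R) ℕ) (i : ℕ) (N : Type u) [AddCommGroup N]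
    [Module R N] : Prop :=
  ∀ z : N ⊗[R] P.X i, (∀ j, (P.d i j).hom.lTensor N z = 0) →
    IsTorsionMod L (LinearMap.range ((P.d (i + 1) i).hom.lTensor N)) z

variable {L}

/-- `Tor` is derived in its second variable, so a single resolution of M serves all N, and N varies
only as a coefficient module. -/
lemma localizing_tor_iff [IsLocalizingSubcategory L] {M : ModuleCat.{u} R}
    (P : ProjectiveResolution M) (N : ModuleCat.{u} R)
    (i : ℕ) :
    L (((Tor (ModuleCat.{u} R) i).obj N).obj M) ↔ TensorTorsion L P.complex i N := by
  have e := P.isoLeftDerivedObj ((MonoidalCategory.tensoringLeft (ModuleCat.{u} R)).obj N) i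
  have h := L.prop_iff_of_iso e
  refine h.trans ((localizing_homology_iff _ _).trans ?_)
  have : (ComplexShape.down ℕ).prev i = i + 1 := ChainComplex.prev ℕ i
  rw [this]
  rfl

variable {P : ChainComplex (ModuleCat.{u} R) ℕ}

lemma lTensor_d_d (N : Type u) [AddCommGroup N] [Module R N] (i j k : ℕ) (z : N ⊗[R] P.X i) :
    (P.d j k).hom.lTensor N ((P.d i j).hom.lTensor N z) = 0 := by
  rw [← LinearMap.comp_apply, ← LinearMap.lTensor_comp, ← ModuleCat.hom_comp, P.d_comp_d]
  simp

lemma lTensor_rTensor_comm {A B X Y : Type*} [AddCommGroup A] [Module R A] [AddCommGroup B]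
    [Module R B] [AddCommGroup X] [Module R X] [AddCommGroup Y] [Module R Y] (f : A →ₗ[R] B)
    (g : X →ₗ[R] Y) (z : A ⊗[R] X) :
    g.lTensor B (f.rTensor X z) = f.rTensor Y (g.lTensor A z) := by
  rw [← LinearMap.comp_apply, ← LinearMap.comp_apply, LinearMap.lTensor_comp_rTensor,
    LinearMap.rTensor_comp_lTensor]

variable {A B C : Type u} [AddCommGroup A] [Module R A] [AddCommGroup B] [Module R B]
    [AddCommGroup C] [Module R C] {f : A →ₗ[R] B} {g : B →ₗ[R] C}

/-- Transport of torsion along a map `N → N'`. -/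
lemma IsTorsionMod.rTensor {i : ℕ} {z : A ⊗[R] P.X i}
    (h : IsTorsionMod L (LinearMap.range ((P.d (i + 1) i).hom.lTensor A)) z) (f : A →ₗ[R] B) :
    IsTorsionMod L (LinearMap.range ((P.d (i + 1) i).hom.lTensor B)) (f.rTensor _ z) := by
  refine h.map (f.rTensor _) ?_
  rintro _ ⟨w, rfl⟩
  exact ⟨f.rTensor _ w, lTensor_rTensor_comm _ _ _⟩

lemma TensorTorsion.right_zero (hf : Function.Surjective f) (hA : TensorTorsion L P 0 A) :
    TensorTorsion L P 0 B := by
  intro z _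
  obtain ⟨z, rfl⟩ := LinearMap.rTensor_surjective _ hf z
  exact (hA z fun j => by rw [P.shape _ _ (by simp)]; simp).rTensor f

variable [∀ i, Module.Flat R (P.X i)]

/-- `TensorTorsion` can be tested on finitely generated submodules. -/
lemma TensorTorsion.of_finite {i : ℕ}
    (h : ∀ N : Submodule R A, N.FG → TensorTorsion L P i N) : TensorTorsion L P i A := by
  intro z hz
  obtain ⟨N, hN, hzN⟩ := TensorProduct.exists_finite_submodule_left_of_setFinite {z}
    (Set.finite_singleton z)
  obtain ⟨y, hy⟩ := hzN rfl
  change N.subtype.rTensor _ y = z at hy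
  subst hy
  exact (h N (Module.Finite.iff_fg.1 hN) y fun j => by
    -- By flatness the lift of the cycle z to the submodule is itself a cycle.
    apply Module.Flat.rTensor_preserves_injective_linearMap N.subtype N.subtype_injective
    rw [← lTensor_rTensor_comm, hz, map_zero]).rTensor _

variable [IsLocalizingSubcategory L]

/-- As P is flat, 0 → A ⊗ P → B ⊗ P → C ⊗ P → 0 is exact. This and the next two lemmas chase its
long exact homology sequence, each hypothesis costing multiplication by a dense ideal. -/
lemma TensorTorsion.mid (hf : Function.Injective f) (hg : Function.Surjective g)
    (h : Function.Exact f g) {i : ℕ} (hA : TensorTorsion L P i A) (hC : TensorTorsion L P i C) :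
    TensorTorsion L P i B := by
  intro z hz
  obtain ⟨J, hJ, hJz⟩ := hC (g.rTensor _ z) fun j => by
    rw [lTensor_rTensor_comm, hz j, map_zero]
  refine isTorsionMod_of_smul hJ fun a ha => ?_
  obtain ⟨w, hw⟩ := hJz a ha
  obtain ⟨w, rfl⟩ := LinearMap.rTensor_surjective _ hg w
  rw [lTensor_rTensor_comm, ← map_smul] at hw
  obtain ⟨y, hy⟩ := ((rTensor_exact _ h hg) (a • z - (P.d (i + 1) i).hom.lTensor B w)).1
    (by rw [map_sub, hw, sub_self])
  have hyc : ∀ j, (P.d i j).hom.lTensor A y = 0 := by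
    intro j
    apply Module.Flat.rTensor_preserves_injective_linearMap f hf
    rw [← lTensor_rTensor_comm, hy, map_sub, map_smul, hz, lTensor_d_d]
    simp
  have := ((hA y hyc).rTensor f).add (isTorsionMod_of_mem ⟨w, rfl⟩)
  rwa [hy, sub_add_cancel] at this

lemma TensorTorsion.left (hf : Function.Injective f) (hg : Function.Surjective g)
    (h : Function.Exact f g) {i : ℕ} (hB : TensorTorsion L P i B)
    (hC : TensorTorsion L P (i + 1) C) : TensorTorsion L P i A := by
  intro z hz
  obtain ⟨J, hJ, hJz⟩ := hB (f.rTensor _ z) fun j => by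
    rw [lTensor_rTensor_comm, hz j, map_zero]
  refine isTorsionMod_of_smul hJ fun a ha => ?_
  obtain ⟨w, hw⟩ := hJz a ha
  obtain ⟨J', hJ', hJw⟩ := hC (g.rTensor _ w) fun j => by
    rw [lTensor_rTensor_comm]
    rcases eq_or_ne (j + 1) (i + 1) with hj | hj
    · obtain rfl : j = i := by omega
      rw [hw, ← map_smul, ← LinearMap.comp_apply, ← LinearMap.rTensor_comp,
        h.linearMap_comp_eq_zero]
      simp
    · rw [P.shape _ _ hj]; simp
  refine ⟨J', hJ', fun b hb => ?_⟩
  obtain ⟨v, hv⟩ := hJw b hb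
  obtain ⟨v, rfl⟩ := LinearMap.rTensor_surjective _ hg v
  rw [lTensor_rTensor_comm, ← map_smul] at hv
  -- Corrected by a boundary, b • w maps to zero in C ⊗ P, so it comes from A ⊗ P and bounds b • a •
  -- z there.
  obtain ⟨y, hy⟩ := ((rTensor_exact _ h hg) (b • w - (P.d (i + 1 + 1) (i + 1)).hom.lTensor B v)).1
    (by rw [map_sub, hv, sub_self])
  refine ⟨y, ?_⟩
  apply Module.Flat.rTensor_preserves_injective_linearMap f hf
  rw [← lTensor_rTensor_comm, hy, map_sub, map_smul, hw, lTensor_d_d]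
  simp

lemma TensorTorsion.right (hf : Function.Injective f) (hg : Function.Surjective g)
    (h : Function.Exact f g) {i : ℕ} (hB : TensorTorsion L P (i + 1) B)
    (hA : TensorTorsion L P i A) : TensorTorsion L P (i + 1) C := by
  intro z hz
  obtain ⟨z, rfl⟩ := LinearMap.rTensor_surjective _ hg z
  obtain ⟨y, hy⟩ := ((rTensor_exact _ h hg) ((P.d (i + 1) i).hom.lTensor B z)).1
    (by rw [← lTensor_rTensor_comm]; exact hz i)
  obtain ⟨J, hJ, hJy⟩ := hA y fun j => by
    apply Module.Flat.rTensor_preserves_injective_linearMap f hf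
    rw [← lTensor_rTensor_comm, hy, lTensor_d_d, map_zero]
  refine isTorsionMod_of_smul hJ fun a ha => ?_
  obtain ⟨w, hw⟩ := hJy a ha
  -- Subtracting w, whose boundary is a • y, turns a • z into a cycle without changing its image in
  -- C ⊗ P.
  have := (hB (a • z - f.rTensor _ w) fun j => by
    rcases eq_or_ne (j + 1) (i + 1) with hj | hj
    · obtain rfl : j = i := by omega
      rw [map_sub, lTensor_rTensor_comm, hw, map_smul, map_smul, hy, sub_self]
    · rw [P.shape _ _ hj]; simp).rTensor g
  rwa [map_sub, ← LinearMap.comp_apply, ← LinearMap.rTensor_comp, h.linearMap_comp_eq_zero,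
    LinearMap.rTensor_zero, LinearMap.zero_apply, sub_zero, map_smul] at this

/-- The classes of modules `N` with `Tor_j(N, M) ∈ L`. -/
def torClass (L : ObjectProperty (ModuleCat.{u} R)) (M : ModuleCat.{u} R) (j : ℕ) :
    ObjectProperty (ModuleCat.{u} R) :=
  fun N => L (((Tor (ModuleCat.{u} R) j).obj N).obj M)

lemma torClass_iff {M : ModuleCat.{u} R} (P : ProjectiveResolution M) (i : ℕ) (A : Type u)
    [AddCommGroup A] [Module R A] :
    torClass L M i (ModuleCat.of R A) ↔ TensorTorsion L P.complex i A :=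
  localizing_tor_iff P _ i

lemma flat_complex {M : ModuleCat.{u} R} (P : ProjectiveResolution M) (i : ℕ) :
    Module.Flat R (P.complex.X i) := by
  have : Module.Projective R (P.complex.X i) :=
    (IsProjective.iff_projective _).2 (inferInstanceAs (Projective (P.complex.X i)))
  infer_instance

lemma lTensor_exact_of_flat {M : ModuleCat.{u} R} (P : ProjectiveResolution M) (i : ℕ)
    (A : Type u) [AddCommGroup A] [Module R A] [Module.Flat R A] :
    Function.Exact ((P.complex.d (i + 2) (i + 1)).hom.lTensor A)
      ((P.complex.d (i + 1) i).hom.lTensor A) :=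
  Module.Flat.lTensor_exact A
    ((ShortComplex.ShortExact.moduleCat_exact_iff_function_exact _).1 (P.exact_succ i))

lemma isDeltaClass_tor (M : ModuleCat.{u} R) : IsDeltaClass (torClass L M) := by
  have P := projectiveResolution M
  have := flat_complex P
  refine ⟨?_, ?_, ?_, ?_, ?_, ?_⟩
  all_goals simp only [torClass_iff P]
  · intro j A _ _ _ z _
    rw [Subsingleton.elim z 0]
    exact isTorsionMod_of_mem (Submodule.zero_mem _)
  · intro j A _ _ _ z hz
    exact isTorsionMod_of_mem ((lTensor_exact_of_flat P j A z).1 (hz j))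
  · intro j A B C _ _ _ _ _ _ f g hf hg h
    exact TensorTorsion.mid hf hg h
  · intro j A B C _ _ _ _ _ _ f g hf hg h
    exact TensorTorsion.left hf hg h
  · intro j A B C _ _ _ _ _ _ f g hf hg h
    exact TensorTorsion.right hf hg h
  · intro A B _ _ _ _ f hf
    exact TensorTorsion.right_zero hf

lemma torClass_of_finite {M : ModuleCat.{u} R} {i : ℕ}
    (h : ∀ N : Submodule R A, N.FG → torClass L M i (ModuleCat.of R N)) :
    torClass L M i (ModuleCat.of R A) := by
  have P := projectiveResolution M
  have := flat_complex P
  simp only [torClass_iff P] at h ⊢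
  exact TensorTorsion.of_finite h

lemma exists_augmentation {M : ModuleCat.{u} R} (P : ProjectiveResolution M) :
    ∃ ε : P.complex.X 0 →ₗ[R] M, Function.Surjective ε ∧
      Function.Exact (P.complex.d 1 0).hom ε := by
  let e : ((ChainComplex.single₀ (ModuleCat.{u} R)).obj M).X 0 ≅ M := Iso.refl _
  have h : (ShortComplex.mk _ _ P.complex_d_comp_π_f_zero).Exact :=
    ShortComplex.exact_of_g_is_cokernel _ P.isColimitCokernelCofork
  have h' := (ShortComplex.ShortExact.moduleCat_exact_iff_function_exact _).1 h
  exact ⟨(P.π.f 0).hom, (ModuleCat.epi_iff_surjective (P.π.f 0)).1 inferInstance, h'⟩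

lemma torClass_zero_iff (M : ModuleCat.{u} R) :
    torClass L M 0 (ModuleCat.of R A) ↔ L (ModuleCat.of R (A ⊗[R] M)) := by
  have P := projectiveResolution M
  obtain ⟨ε, hε, hex⟩ := exists_augmentation P
  have hex' := lTensor_exact A hex hε
  have hs := LinearMap.lTensor_surjective A hε
  rw [torClass_iff P, localizing_iff (L := L), hs.forall]
  have hcyc (z : A ⊗[R] P.complex.X 0) (j : ℕ) : (P.complex.d 0 j).hom.lTensor A z = 0 := by
    rw [P.complex.shape _ _ (by simp)]; simp
  refine forall_congr' fun z => ?_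
  simp only [hcyc, implies_true, forall_const, IsTorsionMod, Submodule.mem_bot, ← map_smul]
  refine exists_congr fun J => and_congr_right fun _ => forall₂_congr fun a _ => ?_
  exact (hex' (a • z)).symm

/-- For a short exact sequence `0 → A → B → C → 0` with `B` flat, `Tor_1(C, M)` is in `L` if and
only if the kernel of `A ⊗ M → B ⊗ M` is in `L`. -/
lemma torClass_one_iff (M : ModuleCat.{u} R) [Module.Flat R B] (hf : Function.Injective f)
    (hg : Function.Surjective g) (h : Function.Exact f g) :
    torClass L M 1 (ModuleCat.of R C) ↔
      ∀ y : A ⊗[R] M, f.rTensor M y = 0 → IsTorsionMod L ⊥ y := by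
  have P := projectiveResolution M
  have := flat_complex P
  obtain ⟨ε, hε, hex⟩ := exists_augmentation P
  rw [torClass_iff P]
  constructor
  · intro hC y hy
    obtain ⟨y, rfl⟩ := LinearMap.lTensor_surjective A hε y
    rw [← lTensor_rTensor_comm] at hy
    obtain ⟨z, hz⟩ := (lTensor_exact B hex hε _).1 hy
    obtain ⟨J, hJ, hJz⟩ := hC (g.rTensor _ z) fun j => by
      rw [lTensor_rTensor_comm]
      rcases eq_or_ne (j + 1) 1 with hj | hj
      · obtain rfl : j = 0 := by omega
        rw [hz, ← LinearMap.comp_apply, ← LinearMap.rTensor_comp, h.linearMap_comp_eq_zero]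
        simp
      · rw [P.complex.shape _ _ hj]; simp
    refine ⟨J, hJ, fun a ha => ?_⟩
    obtain ⟨v, hv⟩ := hJz a ha
    obtain ⟨v, rfl⟩ := LinearMap.rTensor_surjective _ hg v
    rw [lTensor_rTensor_comm, ← map_smul] at hv
    obtain ⟨w, hw⟩ := ((rTensor_exact _ h hg) (a • z - (P.complex.d 2 1).hom.lTensor B v)).1
      (by rw [map_sub, hv, sub_self])
    rw [Submodule.mem_bot, ← map_smul]
    refine (lTensor_exact A hex hε _).2 ⟨w, ?_⟩
    apply Module.Flat.rTensor_preserves_injective_linearMap f hf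
    rw [← lTensor_rTensor_comm, hw, map_sub, map_smul, hz, lTensor_d_d]
    simp
  · intro hA z hz
    obtain ⟨z, rfl⟩ := LinearMap.rTensor_surjective _ hg z
    obtain ⟨y, hy⟩ := ((rTensor_exact _ h hg) ((P.complex.d 1 0).hom.lTensor B z)).1
      (by rw [← lTensor_rTensor_comm]; exact hz 0)
    obtain ⟨J, hJ, hJy⟩ := hA (ε.lTensor A y) (by
      rw [← lTensor_rTensor_comm, hy]
      exact (lTensor_exact B hex hε _).2 ⟨z, rfl⟩)
    refine ⟨J, hJ, fun a ha => ?_⟩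
    have h0 := hJy a ha
    rw [Submodule.mem_bot, ← map_smul] at h0
    obtain ⟨w, hw⟩ := (lTensor_exact A hex hε _).1 h0
    obtain ⟨v, hv⟩ := ((lTensor_exact_of_flat P 0 B) (a • z - f.rTensor _ w)).1 (by
      rw [map_sub, lTensor_rTensor_comm, hw, map_smul, map_smul, hy, sub_self])
    refine ⟨g.rTensor _ v, ?_⟩
    rw [lTensor_rTensor_comm, hv, map_sub, ← LinearMap.comp_apply, ← LinearMap.rTensor_comp,
      h.linearMap_comp_eq_zero, LinearMap.rTensor_zero, LinearMap.zero_apply, sub_zero, map_smul]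

end TorClass

lemma exists_smul_eq_zero_of_finite {R : Type*} [CommRing R] {p : Ideal R}
    (hp : p.IsPrime) {N : Type*} [AddCommGroup N]
    [Module R N] [Module.Finite R N] (h : ∀ z : N, ∃ s ∉ p, s • z = 0) :
    ∃ s ∉ p, s ∈ Module.annihilator R N := by
  obtain ⟨n, z, hz⟩ := Module.Finite.exists_fin (R := R) (M := N)
  choose s hs h using fun i => h (z i)
  refine ⟨∏ i, s i, ?_, ?_⟩
  · rw [hp.prod_mem_iff]
    rintro ⟨i, -, hi⟩
    exact hs i hi
  · rw [← Submodule.annihilator_top, ← hz, Submodule.mem_annihilator_span]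
    rintro ⟨_, i, rfl⟩
    obtain ⟨c, hc⟩ := Finset.dvd_prod_of_mem s (Finset.mem_univ i)
    rw [hc, mul_comm, mul_smul]
    simp [h]

/-! ### Reduction of Tor to prime quotients and residue fields -/

section TorDevissage

variable {R : Type u} [CommRing R] [IsNoetherianRing R] {S L : ObjectProperty (ModuleCat.{u} R)}
  [S.IsSerreClass]

/-- Evaluation at n generators embeds R/ann(N) in N^n, so R/ann(N) is in `S`, and hence so is R/q
for every prime q containing ann(N). These are the only primes met in the dévissage of N. -/
lemma IsDeltaClass.of_serre_of_finite {D : ℕ → ObjectProperty (ModuleCat.{u} R)}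
    (hD : IsDeltaClass D) {j : ℕ}
    (h : ∀ p : Ideal R, p.IsPrime → S (ModuleCat.of R (R ⧸ p)) → D j (ModuleCat.of R (R ⧸ p)))
    (N : Type u) [AddCommGroup N] [Module R N] [Module.Finite R N] (hN : S (ModuleCat.of R N)) :
    D j (ModuleCat.of R N) := by
  obtain ⟨n, s, hs⟩ := Module.Finite.exists_fin (R := R) (M := N)
  refine hD.of_finite j (J := Module.annihilator R N) (fun q hq hle => h q hq ?_) le_rfl
  refine serre_quotient_of_le S hle ?_
  let f : R →ₗ[R] (Fin n → N) := LinearMap.pi fun i => LinearMap.toSpanSingleton R N (s i)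
  have hf : LinearMap.ker f = Module.annihilator R N := by
    ext a
    rw [LinearMap.mem_ker, ← Submodule.annihilator_top, ← hs, Submodule.mem_annihilator_span]
    simp [f, funext_iff]
  rw [← hf]
  exact serre_of_injective S _ (LinearMap.ker_eq_bot.1 (Submodule.ker_liftQ_eq_bot _ f le_rfl le_rfl))
    (serre_pow S hN n)

variable [IsLocalizingSubcategory L] {M : ModuleCat.{u} R}

lemma torClass_of_serre {i : ℕ} (h : ∀ p : Ideal R, p.IsPrime → S (ModuleCat.of R (R ⧸ p)) →
      torClass L M i (ModuleCat.of R (R ⧸ p)))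
    (N : ModuleCat.{u} R) (hN : S N) : torClass L M i N := by
  refine torClass_of_finite (A := N) fun N' hN' => ?_
  have : Module.Finite R N' := Module.Finite.iff_fg.2 hN'
  exact (isDeltaClass_tor M).of_serre_of_finite h N'
    (serre_of_injective S N'.subtype N'.subtype_injective hN)

/-- The residue field need not lie in `S`, but its finitely generated submodules are killed by p and
therefore do. -/
lemma torClass_residueField {i : ℕ} (h : ∀ p : Ideal R, p.IsPrime → S (ModuleCat.of R (R ⧸ p)) →
      torClass L M i (ModuleCat.of R (R ⧸ p)))
    (p : Ideal R) [p.IsPrime] (hp : S (ModuleCat.of R (R ⧸ p))) :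
    torClass L M i (ModuleCat.of R p.ResidueField) := by
  refine torClass_of_finite fun N hN => ?_
  have : Module.Finite R N := Module.Finite.iff_fg.2 hN
  refine (isDeltaClass_tor M).of_serre_of_finite h N (serre_of_finite S hp fun a ha => ?_)
  rw [Module.mem_annihilator]
  intro z
  ext
  rw [Submodule.coe_smul, Algebra.smul_def, Ideal.algebraMap_residueField_eq_zero.2 ha]
  simp

/-- Noetherian induction on p, along 0 → R/p → k(p) → C → 0. Finitely generated submodules of C are
killed by p and by some s outside p, so their dévissage uses only primes strictly larger than p. The
induction hypothesis must hold in all degrees, because Tor_i of R/p requires Tor_{i+1} of C. -/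
lemma torClass_prime_of_residueField
    (h : ∀ (p : Ideal R) [p.IsPrime], S (ModuleCat.of R (R ⧸ p)) →
      ∀ i, torClass L M i (ModuleCat.of R p.ResidueField)) (p : Ideal R) :
    p.IsPrime → S (ModuleCat.of R (R ⧸ p)) → ∀ i, torClass L M i (ModuleCat.of R (R ⧸ p)) := by
  induction p using WellFoundedGT.induction with
  | _ p ih =>
  intro hp hS i
  let f : (R ⧸ p) →ₗ[R] p.ResidueField :=
    (IsScalarTower.toAlgHom R (R ⧸ p) p.ResidueField).toLinearMap
  have hf : Function.Injective f := FaithfulSMul.algebraMap_injective (R ⧸ p) p.ResidueField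
  refine (isDeltaClass_tor M).left i f (LinearMap.range f).mkQ hf (Submodule.mkQ_surjective _)
    (LinearMap.exact_map_mkQ_range f) (h p hS i) ?_
  refine torClass_of_finite fun N hN => ?_
  have : Module.Finite R N := Module.Finite.iff_fg.2 hN
  -- Each element of k(p) is a fraction a/b of elements of R/p, and b kills its class modulo R/p;
  -- finitely many generators then have a common killer outside p.
  obtain ⟨s, hsp, hs⟩ := exists_smul_eq_zero_of_finite hp (N := N) (by
    rintro ⟨z, hz⟩
    obtain ⟨z, rfl⟩ := Submodule.mkQ_surjective _ z
    obtain ⟨a, b, hb, rfl⟩ := IsFractionRing.div_surjective (A := R ⧸ p) z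
    obtain ⟨b, rfl⟩ := Ideal.Quotient.mk_surjective b
    have hb0 := nonZeroDivisors.ne_zero hb
    refine ⟨b, fun hbp => hb0 (Ideal.Quotient.eq_zero_iff_mem.2 hbp), ?_⟩
    ext
    rw [Submodule.coe_smul]
    change b • (LinearMap.range f).mkQ _ = 0
    rw [← map_smul, Submodule.mkQ_apply, Submodule.Quotient.mk_eq_zero]
    refine ⟨a, ?_⟩
    have : algebraMap (R ⧸ p) p.ResidueField (Ideal.Quotient.mk p b) ≠ 0 := by
      rwa [Ne, FaithfulSMul.algebraMap_eq_zero_iff]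
    rw [Algebra.smul_def, IsScalarTower.algebraMap_apply R (R ⧸ p) p.ResidueField]
    exact (mul_div_cancel₀ _ this).symm)
  have hpN : p ≤ Module.annihilator R N := by
    intro a ha
    rw [Module.mem_annihilator]
    rintro ⟨z, hz⟩
    obtain ⟨z, rfl⟩ := Submodule.mkQ_surjective _ z
    ext
    rw [Submodule.coe_smul]
    change a • (LinearMap.range f).mkQ _ = 0
    rw [← map_smul, Algebra.smul_def, Ideal.algebraMap_residueField_eq_zero.2 ha, zero_mul,
      map_zero]
  refine (isDeltaClass_tor M).of_finite _ (J := p ⊔ Ideal.span {s}) (fun q hq hle => ?_)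
    (sup_le hpN ((Ideal.span_singleton_le_iff_mem _).2 hs))
  have hpq : p ≤ q := le_sup_left.trans hle
  have hsq : s ∈ q := hle (Ideal.mem_sup_right (Ideal.mem_span_singleton_self s))
  exact ih q (lt_of_le_of_ne hpq fun e => hsp (e ▸ hsq)) hq (serre_quotient_of_le S hpq hS) _

end TorDevissage

/-! ### Homology of the Koszul complex and elementwise criteria -/

namespace Koszul

open TensorProduct

variable {R : Type u} [CommRing R] {n : ℕ}

lemma sign_mul_self (t : Finset (Fin n)) (i : Fin n) : sign R t i * sign R t i = 1 := by
  rw [sign, ← pow_add, ← two_mul, pow_mul]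
  simp

lemma complex_d (x : Fin n → R) (p : ℕ) :
    (complex x).d (p + 1) p = ModuleCat.ofHom (d x p) :=
  ChainComplex.of_d (fun p => ModuleCat.of R (Idx n p → R)) (fun p => ModuleCat.ofHom (d x p)) p

/-- The homology of a Koszul complex is killed by the elements of the sequence. -/
lemma exists_d_eq_smul (x : Fin n → R) (p : ℕ) (i : Fin n) (z : Idx n (p + 1) → R)
    (hz : d x p z = 0) : ∃ w, d x (p + 1) w = x i • z := by
  have hcard {s : Idx n (p + 2)} (h : i ∈ s.1) : (s.1.erase i).card = p + 1 := by
    rw [Finset.card_erase_of_mem h, s.2]; rfl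
  -- This is e_i ∧ z; the homotopy formula d(e_i ∧ z) = x_i z - e_i ∧ dz gives the claim for a cycle
  -- z.
  let w : Idx n (p + 2) → R := fun s =>
    if h : i ∈ s.1 then sign R (s.1.erase i) i * z ⟨s.1.erase i, hcard h⟩ else 0
  refine ⟨w, funext fun t => ?_⟩
  change (∑ j : Fin n, if hj : j ∉ t.1 then sign R t.1 j * x j * w (t.insert j hj) else 0) =
    x i * z t
  by_cases hi : i ∈ t.1
  · have hu : (t.1.erase i).card = p := by
      rw [Finset.card_erase_of_mem hi, t.2]; rfl
    let u : Idx n p := ⟨t.1.erase i, hu⟩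
    have hiu : i ∉ u.1 := Finset.notMem_erase i t.1
    have hui : u.insert i hiu = t := Subtype.ext (Finset.insert_erase hi)
    have h0 : (∑ j : Fin n, if hj : j ∉ u.1 then sign R u.1 j * x j * z (u.insert j hj) else 0)
      = 0 := congrFun hz u
    -- The homotopy formula at the coordinate t containing i, term by term: the term j = i gives x_i
    -- z, and the others assemble to the coordinate of -(e_i ∧ dz).
    have key : ∀ j : Fin n,
        (if hj : j ∉ t.1 then sign R t.1 j * x j * w (t.insert j hj) else 0) =
        (if j = i then x i * z t else 0) - sign R u.1 i *
          (if hj : j ∉ u.1 then sign R u.1 j * x j * z (u.insert j hj) else 0) := by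
      intro j
      by_cases hji : j = i
      · subst hji
        rw [dif_neg (by simpa using hi), if_pos rfl, dif_pos hiu, hui]
        linear_combination (x j * z t) * sign_mul_self (R := R) u.1 j
      · by_cases hj : j ∈ t.1
        · have : j ∈ u.1 := Finset.mem_erase.2 ⟨hji, hj⟩
          simp [hj, hji, this]
        · have hju : j ∉ u.1 := fun h => hj (Finset.mem_of_mem_erase h)
          rw [dif_pos hj, if_neg hji, dif_pos hju]
          have h1 : (t.insert j hj).1.erase i = insert j u.1 := by
            change (insert j t.1).erase i = insert j (t.1.erase i)
            rw [Finset.erase_insert_of_ne hji]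
          have h2 : w (t.insert j hj) = sign R (insert j u.1) i * z (u.insert j hju) := by
            have : i ∈ (t.insert j hj).1 := Finset.mem_insert_of_mem hi
            simp only [w, dif_pos this, h1]
            rfl
          have h3 := sign_antisymm (R := R) hiu hju (Ne.symm hji)
          have h4 : insert i u.1 = t.1 := Finset.insert_erase hi
          rw [h4] at h3
          have h5 := sign_mul_self (R := R) u.1 i
          have h6 := sign_mul_self (R := R) (insert j u.1) i
          rw [h2]
          linear_combination (sign R u.1 i * sign R (insert j u.1) i * x j * z (u.insert j hju)) * h3
            - (sign R t.1 j * sign R (insert j u.1) i * x j * z (u.insert j hju)) * h5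
            - (sign R u.1 i * sign R u.1 j * x j * z (u.insert j hju)) * h6
    rw [Finset.sum_congr rfl fun j _ => key j, Finset.sum_sub_distrib, ← Finset.mul_sum, h0]
    simp
  · rw [Finset.sum_eq_single i]
    · rw [dif_pos hi]
      have h1 : (t.insert i hi).1.erase i = t.1 := Finset.erase_insert hi
      have h2 : w (t.insert i hi) = sign R t.1 i * z t := by
        have : i ∈ (t.insert i hi).1 := Finset.mem_insert_self i t.1
        simp only [w, dif_pos this, h1]
      rw [h2]
      linear_combination (x i * z t) * sign_mul_self (R := R) t.1 i
    · intro j _ hji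
      by_cases hj : j ∈ t.1
      · simp [hj]
      · have : i ∉ (t.insert j hj).1 := by
          simp [Idx.insert, Ne.symm hji, hi]
        simp [w, this]
    · simp

lemma le_annihilator_homology (x : Fin n → R) (q : ℕ) :
    Ideal.span (Set.range x) ≤ Module.annihilator R
      (LinearMap.ker (IsDeltaClass.cokerToBoundaries (K := fun q => Idx n q → R) (d x) (d_comp_d x) q)) := by
  rw [Ideal.span_le]
  rintro _ ⟨i, rfl⟩
  rw [SetLike.mem_coe, Module.mem_annihilator]
  rintro ⟨z, hz⟩
  obtain ⟨z, rfl⟩ := Submodule.Quotient.mk_surjective _ z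
  obtain ⟨w, hw⟩ := exists_d_eq_smul x q i z (congrArg Subtype.val hz)
  ext
  rw [Submodule.coe_smul, ← Submodule.Quotient.mk_smul, ZeroMemClass.coe_zero,
    Submodule.Quotient.mk_eq_zero]
  exact ⟨w, hw⟩

/-- The zeroth homology of the Koszul complex of `x` is `R ⧸ (x)`. -/
lemma exists_homology_zero_equiv (x : Fin n → R) :
    Nonempty (((Idx n 0 → R) ⧸ LinearMap.range (d x 0)) ≃ₗ[R] R ⧸ Ideal.span (Set.range x)) := by
  let o : Idx n 0 := ⟨∅, rfl⟩
  let : Unique (Idx n 0) := ⟨⟨o⟩, fun s => Subtype.ext (Finset.card_eq_zero.1 s.2)⟩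
  let e : (Idx n 0 → R) ≃ₗ[R] R := LinearEquiv.funUnique (Idx n 0) R R
  have hd0 (f : Idx n 1 → R) : d x 0 f o = ∑ i, x i * f (o.insert i (Finset.notMem_empty i)) := by
    change (∑ i : Fin n, if hi : i ∉ o.1 then sign R o.1 i * x i * f (o.insert i hi) else 0) = _
    refine Finset.sum_congr rfl fun i _ => ?_
    rw [dif_pos (Finset.notMem_empty i)]
    simp [sign, o]
  refine ⟨Submodule.Quotient.equiv _ _ e (le_antisymm ?_ ?_)⟩
  · rintro _ ⟨_, ⟨f, rfl⟩, rfl⟩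
    change d x 0 f o ∈ Ideal.span (Set.range x)
    rw [hd0]
    exact Ideal.sum_mem _ fun i _ => Ideal.mul_mem_right _ _ (Ideal.subset_span ⟨i, rfl⟩)
  · rw [Ideal.span_le]
    rintro _ ⟨i, rfl⟩
    refine ⟨d x 0 (Pi.single (o.insert i (Finset.notMem_empty i)) 1), ⟨_, rfl⟩, ?_⟩
    change d x 0 (Pi.single (o.insert i (Finset.notMem_empty i)) 1) o = x i
    rw [hd0, Finset.sum_eq_single i]
    · simp
    · intro j _ hji
      rw [Pi.single_eq_of_ne, mul_zero]
      intro h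
      exact hji (by simpa [Idx.insert, o] using congrArg Subtype.val h)
    · simp

section Localizing

variable {L : ObjectProperty (ModuleCat.{u} R)} [IsLocalizingSubcategory L] (x : Fin n → R)
  (M : ModuleCat.{u} R)

lemma homology_zero_iff : L (homology x M 0) ↔ ∀ z : (Idx n 0 → R) ⊗[R] M,
    IsTorsionMod L (LinearMap.range ((d x 0).rTensor M)) z := by
  refine (localizing_homology_iff _ _).trans ?_
  rw [ChainComplex.prev]
  have h1 : ∀ (z : (Idx n 0 → R) ⊗[R] M) (j : ℕ),
      ((complex x).d 0 j).hom.rTensor M z = 0 := by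
    intro z j
    rw [(complex x).shape _ _ (by simp)]
    simp only [ModuleCat.hom_zero, LinearMap.rTensor_zero]
    rfl
  have h2 : LinearMap.range (((complex x).d 1 0).hom.rTensor M) =
      LinearMap.range ((d x 0).rTensor M) := by rw [complex_d]; rfl
  rw [← h2]
  exact forall_congr' fun z => ⟨fun h => h (h1 z), fun h _ => h⟩

lemma homology_succ_iff (q : ℕ) : L (homology x M (q + 1)) ↔ ∀ z : (Idx n (q + 1) → R) ⊗[R] M,
    (d x q).rTensor M z = 0 → IsTorsionMod L (LinearMap.range ((d x (q + 1)).rTensor M)) z := by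
  refine (localizing_homology_iff _ _).trans ?_
  rw [ChainComplex.prev]
  have h1 : ∀ (z : (Idx n (q + 1) → R) ⊗[R] M), (d x q).rTensor M z = 0 ↔
      ∀ j, ((complex x).d (q + 1) j).hom.rTensor M z = 0 := by
    intro z
    refine ⟨fun h j => ?_, fun h => ?_⟩
    swap
    · have := h q
      rw [complex_d] at this
      exact this
    rcases eq_or_ne (j + 1) (q + 1) with hj | hj
    · obtain rfl : j = q := by omega
      rw [complex_d]; exact h
    · rw [(complex x).shape _ _ hj]
      simp only [ModuleCat.hom_zero, LinearMap.rTensor_zero]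
      rfl
  have h2 : LinearMap.range (((complex x).d (q + 1 + 1) (q + 1)).hom.rTensor M) =
      LinearMap.range ((d x (q + 1)).rTensor M) := by rw [complex_d]; rfl
  rw [← h2]
  exact forall_congr' fun z => imp_congr_left (h1 z).symm

lemma cohomology_zero_iff : L (cohomology x M 0) ↔ ∀ φ : (Idx n 0 → R) →ₗ[R] M,
    φ ∘ₗ d x 0 = 0 → IsTorsionMod L ⊥ φ := by
  refine (localizing_homology_iff _ _).trans ?_
  let e : ((complex x).X 0 ⟶ M) ≃ₗ[R] ((Idx n 0 → R) →ₗ[R] M) := ModuleCat.homLinearEquiv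
  refine e.toEquiv.forall_congr fun z => imp_congr ?_ ?_
  · change (∀ j, (complex x).d j 0 ≫ z = 0) ↔ z.hom ∘ₗ d x 0 = 0
    refine ⟨fun h => ?_, fun h j => ?_⟩
    · have := h 1
      rw [complex_d] at this
      exact congrArg ModuleCat.Hom.hom this
    · rcases eq_or_ne (0 + 1) j with rfl | hj
      · rw [complex_d]
        exact ModuleCat.hom_ext h
      · rw [(complex x).shape _ _ hj, Limits.zero_comp]
  -- Degree 0 has no predecessor, so the incoming differential is the zero default and there are no
  -- coboundaries.
  · rw [HomologicalComplex.shape _ _ _ (by simp), ModuleCat.hom_zero, LinearMap.range_zero]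
    simp only [IsTorsionMod, Submodule.mem_bot]
    refine exists_congr fun J => and_congr_right fun _ => forall₂_congr fun a _ => ?_
    change _ ↔ a • e z = 0
    rw [← map_smul, e.map_eq_zero_iff]
    rfl

lemma cohomology_succ_iff (q : ℕ) : L (cohomology x M (q + 1)) ↔
    ∀ φ : (Idx n (q + 1) → R) →ₗ[R] M, φ ∘ₗ d x (q + 1) = 0 →
      IsTorsionMod L (LinearMap.range (LinearMap.lcomp R M (d x q))) φ := by
  refine (localizing_homology_iff _ _).trans ?_
  let e : ((complex x).X (q + 1) ⟶ M) ≃ₗ[R] ((Idx n (q + 1) → R) →ₗ[R] M) :=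
    ModuleCat.homLinearEquiv
  refine e.toEquiv.forall_congr fun z => imp_congr ?_ ?_
  · change (∀ j, (complex x).d j (q + 1) ≫ z = 0) ↔ z.hom ∘ₗ d x (q + 1) = 0
    refine ⟨fun h => ?_, fun h j => ?_⟩
    · have := h (q + 1 + 1)
      rw [complex_d] at this
      exact congrArg ModuleCat.Hom.hom this
    · rcases eq_or_ne (q + 1 + 1) j with rfl | hj
      · rw [complex_d]
        exact ModuleCat.hom_ext h
      · rw [(complex x).shape _ _ hj, Limits.zero_comp]
  · rw [CochainComplex.prev_nat_succ]
    refine exists_congr fun J => and_congr_right fun _ => forall₂_congr fun a _ => ?_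
    change (∃ w : (complex x).X q ⟶ M, (complex x).d (q + 1) q ≫ w = a • z) ↔
      ∃ w : (Idx n q → R) →ₗ[R] M, w ∘ₗ d x q = a • z.hom
    rw [complex_d]
    exact ⟨fun ⟨w, hw⟩ => ⟨w.hom, congrArg ModuleCat.Hom.hom hw⟩,
      fun ⟨w, hw⟩ => ⟨ModuleCat.ofHom w, ModuleCat.hom_ext hw⟩⟩

end Localizing

end Koszul

/-! ### Koszul homology versus Tor -/

namespace Koszul

open TensorProduct IsDeltaClass

variable {R : Type u} [CommRing R] {n : ℕ} {L : ObjectProperty (ModuleCat.{u} R)}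
  [IsLocalizingSubcategory L] (x : Fin n → R) (M : ModuleCat.{u} R)

/-- The cokernel of the differential `K_(q+1) → K_q` of the Koszul complex. -/
abbrev coker (q : ℕ) : Type u := (Idx n q → R) ⧸ LinearMap.range (d x q)

/-- The homology of the Koszul complex in degree `q + 1`, as a submodule of a cokernel. -/
abbrev homologySucc (q : ℕ) : Submodule R (coker x (q + 1)) :=
  LinearMap.ker (cokerToBoundaries (K := fun q => Idx n q → R) (d x) (d_comp_d x) q)

lemma homology_zero_iff_tor :
    L (homology x M 0) ↔ torClass L M 0 (ModuleCat.of R (coker x 0)) := by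
  rw [homology_zero_iff (L := L), torClass_zero_iff, localizing_iff (L := L),
    (LinearMap.rTensor_surjective M (Submodule.mkQ_surjective (LinearMap.range (d x 0)))).forall]
  refine forall_congr' fun z => exists_congr fun J => and_congr_right fun _ =>
    forall₂_congr fun a _ => ?_
  rw [← map_smul, Submodule.mem_bot]
  exact ((rTensor_exact M (LinearMap.exact_map_mkQ_range (d x 0))
    (Submodule.mkQ_surjective _)) (a • z)).symm

lemma torClass_one_coker_iff (q : ℕ) : torClass L M 1 (ModuleCat.of R (coker x q)) ↔
    ∀ y : LinearMap.range (d x q) ⊗[R] M, (LinearMap.range (d x q)).subtype.rTensor M y = 0 →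
      IsTorsionMod L ⊥ y :=
  torClass_one_iff M (Submodule.subtype_injective _) (Submodule.mkQ_surjective _)
    (exact_subtype_mkQ _)

lemma rTensor_subtype_rangeRestrict {A B : Type*} [AddCommGroup A] [Module R A] [AddCommGroup B]
    [Module R B] (f : A →ₗ[R] B) (z : A ⊗[R] M) :
    (LinearMap.range f).subtype.rTensor M (f.rangeRestrict.rTensor M z) = f.rTensor M z := by
  rw [← LinearMap.comp_apply, ← LinearMap.rTensor_comp]
  rfl

/-- Tor_1(Q_q, M) = ker(B_q ⊗ M → K_q ⊗ M) is a quotient of H_{q+1}(K, M): an element lifts to a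
cycle in K_{q+1} ⊗ M, and boundaries vanish in B_q ⊗ M. -/
lemma torClass_one_coker (q : ℕ) (h : L (homology x M (q + 1))) :
    torClass L M 1 (ModuleCat.of R (coker x q)) := by
  rw [homology_succ_iff (L := L)] at h
  rw [torClass_one_coker_iff]
  intro y hy
  obtain ⟨z, rfl⟩ := LinearMap.rTensor_surjective M (d x q).surjective_rangeRestrict y
  rw [rTensor_subtype_rangeRestrict] at hy
  refine (h z hy).map _ ?_
  rintro _ ⟨w, rfl⟩
  rw [Submodule.mem_comap, Submodule.mem_bot, ← LinearMap.comp_apply, ← LinearMap.rTensor_comp]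
  have : (d x q).rangeRestrict ∘ₗ d x (q + 1) = 0 :=
    LinearMap.ext fun z => Subtype.ext (LinearMap.congr_fun (d_comp_d x q) z)
  rw [this, LinearMap.rTensor_zero, LinearMap.zero_apply]

/-- There is an exact sequence H_{q+1}(K) ⊗ M → H_{q+1}(K, M) → Tor_1(Q_q, M), coming from right
exactness of the tensor product on H_{q+1}(K) → Q_{q+1} → B_q → 0. -/
lemma homology_succ_of_tor (q : ℕ)
    (hH : torClass L M 0 (ModuleCat.of R (homologySucc x q)))
    (hQ : torClass L M 1 (ModuleCat.of R (coker x q))) : L (homology x M (q + 1)) := by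
  rw [torClass_one_coker_iff] at hQ
  rw [torClass_zero_iff, localizing_iff (L := L)] at hH
  rw [homology_succ_iff (L := L)]
  intro z hz
  obtain ⟨J, hJ, hJz⟩ := hQ ((d x q).rangeRestrict.rTensor M z)
    (by rw [rTensor_subtype_rangeRestrict, hz])
  refine isTorsionMod_of_smul hJ fun a ha => ?_
  obtain ⟨y, hy⟩ := ((rTensor_exact M (exact_subtype_ker _)
    (cokerToBoundaries_surjective (K := fun q => Idx n q → R) (d x) (d_comp_d x) q))
      ((LinearMap.range (d x (q + 1))).mkQ.rTensor M (a • z))).1 (by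
    rw [← LinearMap.comp_apply, ← LinearMap.rTensor_comp]
    have := hJz a ha
    rwa [Submodule.mem_bot, ← map_smul] at this)
  obtain ⟨J', hJ', hJy⟩ := hH y
  refine ⟨J', hJ', fun b hb => ?_⟩
  refine ((rTensor_exact M (LinearMap.exact_map_mkQ_range (d x (q + 1)))
    (Submodule.mkQ_surjective _)) (b • a • z)).1 ?_
  have := hJy b hb
  rw [Submodule.mem_bot] at this
  rw [map_smul, ← hy, ← map_smul, this, map_zero]

variable [IsNoetherianRing R]

/-- The modules `Tor_i(N, M)`, for `N` finitely generated and killed by `(x)`, lie in `L` if and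
only if the Koszul homology modules `H_i(K(x), M)` do. -/
theorem homology_iff_tor {I : Ideal R} (hx : Ideal.span (Set.range x) = I) :
    (∀ i, L (homology x M i)) ↔ ∀ (i : ℕ) (N : Type u) [AddCommGroup N] [Module R N]
      [Module.Finite R N], I ≤ Module.annihilator R N → torClass L M i (ModuleCat.of R N) := by
  subst hx
  obtain ⟨e⟩ := exists_homology_zero_equiv x
  constructor
  · intro h
    exact (isDeltaClass_tor M).of_finite_of_coker (K := fun q => Idx n q → R) (d x) (d_comp_d x) e
      (le_annihilator_homology x) ((homology_zero_iff_tor x M).1 (h 0))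
      (fun q => torClass_one_coker x M q (h (q + 1)))
  · intro h
    have h0 (j : ℕ) : torClass L M j (ModuleCat.of R (coker x 0)) :=
      h j _ (by rw [e.annihilator_eq, Ideal.annihilator_quotient])
    have hH (q j : ℕ) : torClass L M j (ModuleCat.of R (homologySucc x q)) :=
      h j _ (le_annihilator_homology x q)
    intro i
    cases i with
    | zero => exact (homology_zero_iff_tor x M).2 (h0 0)
    | succ q =>
      exact homology_succ_of_tor x M q (hH q 0)
        ((isDeltaClass_tor M).coker_of_homology (K := fun q => Idx n q → R) (d x) (d_comp_d x)
          h0 hH q 0)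

end Koszul

/-! ### The classes defined by Ext -/

section ExtClass

variable {R : Type u} [CommRing R]

/-- The classes of modules `N` with `Ext^j(N, M) ∈ L`. -/
def extClass (L : ObjectProperty (ModuleCat.{u} R)) (M : ModuleCat.{u} R) (j : ℕ) :
    ObjectProperty (ModuleCat.{u} R) :=
  fun N => L (ModuleCat.of R (Abelian.Ext.{u} N M j))

variable {L : ObjectProperty (ModuleCat.{u} R)} (M : ModuleCat.{u} R)

open Abelian

/-- Precomposition with `f`, as a linear map on `Ext^j`. -/
noncomputable def extPrecomp {A B : ModuleCat.{u} R} (f : A ⟶ B) (j : ℕ) :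
    Ext.{u} B M j →ₗ[R] Ext.{u} A M j :=
  Ext.bilinearCompOfLinear R A B M 0 j j (zero_add j) (Ext.mk₀ f)

/-- The connecting homomorphism of the contravariant long exact sequence of `Ext`. -/
noncomputable def extConnecting {T : ShortComplex (ModuleCat.{u} R)} (hT : T.ShortExact) (j : ℕ) :
    Ext.{u} T.X₁ M j →ₗ[R] Ext.{u} T.X₃ M (j + 1) :=
  Ext.bilinearCompOfLinear R _ _ M 1 j (j + 1) (add_comm 1 j) hT.extClass

lemma extPrecomp_apply {A B : ModuleCat.{u} R} (f : A ⟶ B) (j : ℕ) (y : Ext.{u} B M j) :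
    extPrecomp M f j y = (Ext.mk₀ f).comp y (zero_add j) := rfl

lemma extConnecting_apply {T : ShortComplex (ModuleCat.{u} R)} (hT : T.ShortExact) (j : ℕ)
    (y : Ext.{u} T.X₁ M j) : extConnecting M hT j y = hT.extClass.comp y (add_comm 1 j) := rfl

section LongExactSequence

variable {T : ShortComplex (ModuleCat.{u} R)} (hT : T.ShortExact) (j : ℕ)

lemma exact_extPrecomp {T : ShortComplex (ModuleCat.{u} R)} (hT : T.ShortExact) (j : ℕ) :
    Function.Exact (extPrecomp M T.g j) (extPrecomp M T.f j) := by
  intro y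
  refine ⟨fun hy => Ext.contravariant_sequence_exact₂ hT M y hy, ?_⟩
  rintro ⟨w, rfl⟩
  rw [extPrecomp_apply, extPrecomp_apply, Ext.mk₀_comp_mk₀_assoc, T.zero, Ext.mk₀_zero,
    Ext.zero_comp]

lemma exact_extPrecomp_extConnecting :
    Function.Exact (extPrecomp M T.f j) (extConnecting M hT j) := by
  intro y
  refine ⟨fun hy => Ext.contravariant_sequence_exact₁ hT M y (add_comm 1 j) hy, ?_⟩
  rintro ⟨w, rfl⟩
  rw [extPrecomp_apply, extConnecting_apply, ShortComplex.ShortExact.extClass_comp_assoc]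

lemma exact_extConnecting_extPrecomp :
    Function.Exact (extConnecting M hT j) (extPrecomp M T.g (j + 1)) := by
  intro y
  refine ⟨fun hy => Ext.contravariant_sequence_exact₃ hT M y hy (add_comm 1 j), ?_⟩
  rintro ⟨w, rfl⟩
  rw [extPrecomp_apply, extConnecting_apply, ShortComplex.ShortExact.comp_extClass_assoc]

end LongExactSequence

lemma ext_succ_subsingleton (A : Type u) [AddCommGroup A] [Module R A] [Module.Free R A] (j : ℕ) :
    Subsingleton (Ext.{u} (ModuleCat.of R A) M (j + 1)) := by
  have : Projective (ModuleCat.of R A) := inferInstance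
  exact ⟨fun a b => by rw [Ext.eq_zero_of_projective a, Ext.eq_zero_of_projective b]⟩

/-- Contravariance reverses the arrows of the long exact sequence but keeps the same three-term
windows: each axiom places its conclusion between its two hypotheses, as for Tor. In degree 0, Hom
turns a surjection into an injection. -/
lemma isDeltaClass_ext [L.IsSerreClass] : IsDeltaClass (extClass L M) where
  subsingleton j A _ _ _ := by
    have h : Limits.IsZero (ModuleCat.of R A) := ModuleCat.isZero_of_subsingleton _
    have : Subsingleton (Ext.{u} (ModuleCat.of R A) M j) := ⟨fun a b => by
      have : 𝟙 (ModuleCat.of R A) = 0 := h.eq_of_src _ _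
      rw [← Ext.mk₀_id_comp a, ← Ext.mk₀_id_comp b, this]
      simp⟩
    exact serre_of_subsingleton L
  free_succ j A _ _ _ := by
    have := ext_succ_subsingleton M A j
    exact serre_of_subsingleton L
  mid j A B C _ _ _ _ _ _ f g hf hg h hA hC := by
    have hT := ModuleCat.shortComplex_shortExact
      (ShortComplex.moduleCatMk f g h.linearMap_comp_eq_zero) h hf hg
    exact serre_of_exact L _ _ (exact_extPrecomp M hT j) hC hA
  left j A B C _ _ _ _ _ _ f g hf hg h hB hC := by
    have hT := ModuleCat.shortComplex_shortExact
      (ShortComplex.moduleCatMk f g h.linearMap_comp_eq_zero) h hf hg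
    exact serre_of_exact L _ _ (exact_extPrecomp_extConnecting M hT j) hB hC
  right j A B C _ _ _ _ _ _ f g hf hg h hB hA := by
    have hT := ModuleCat.shortComplex_shortExact
      (ShortComplex.moduleCatMk f g h.linearMap_comp_eq_zero) h hf hg
    exact serre_of_exact L _ _ (exact_extConnecting_extPrecomp M hT j) hA hB
  right_zero {A B} _ _ _ _ f hf hA := by
    have : Epi (ModuleCat.ofHom f) := (ModuleCat.epi_iff_surjective _).2 hf
    exact serre_of_injective L (extPrecomp M (ModuleCat.ofHom f) 0)
      (Ext.precomp_mk₀_injective_of_epi M (ModuleCat.ofHom f)) hA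

/-- `Ext^0` is `Hom`. -/
noncomputable def extZeroEquiv (A : ModuleCat.{u} R) : Ext.{u} A M 0 ≃ₗ[R] (A →ₗ[R] M) :=
  Ext.linearEquiv₀.trans ModuleCat.homLinearEquiv

lemma extZeroEquiv_symm_apply {A : ModuleCat.{u} R} (φ : A →ₗ[R] M) :
    (extZeroEquiv M A).symm φ = Ext.mk₀ (ModuleCat.ofHom φ) := rfl

lemma extZeroEquiv_symm_comp {A B : ModuleCat.{u} R} (f : A ⟶ B) (φ : B →ₗ[R] M) :
    (extZeroEquiv M A).symm (φ ∘ₗ f.hom) = extPrecomp M f 0 ((extZeroEquiv M B).symm φ) := by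
  rw [extZeroEquiv_symm_apply, extZeroEquiv_symm_apply, extPrecomp_apply, Ext.mk₀_comp_mk₀]
  rfl

lemma extClass_zero_iff [L.IsSerreClass] (A : Type u) [AddCommGroup A] [Module R A] :
    extClass L M 0 (ModuleCat.of R A) ↔ L (ModuleCat.of R (A →ₗ[R] M)) :=
  ⟨serre_of_linearEquiv L (extZeroEquiv M (ModuleCat.of R A)),
    serre_of_linearEquiv L (extZeroEquiv M (ModuleCat.of R A)).symm⟩

/-- As Ext^1 of the middle term vanishes, the connecting map from Hom(X₁, M) is onto, and its kernel
consists of the maps that extend to the middle term. -/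
lemma extClass_one_iff_of_shortExact [IsLocalizingSubcategory L] {T : ShortComplex (ModuleCat.{u} R)}
    (hT : T.ShortExact) [Subsingleton (Ext.{u} T.X₂ M 1)] : extClass L M 1 T.X₃ ↔
      ∀ φ : T.X₁ →ₗ[R] M, IsTorsionMod L (LinearMap.range (LinearMap.lcomp R M T.f.hom)) φ := by
  let δ : (T.X₁ →ₗ[R] M) →ₗ[R] Ext.{u} T.X₃ M 1 :=
    extConnecting M hT 0 ∘ₗ (extZeroEquiv M T.X₁).symm.toLinearMap
  have hδ : Function.Surjective δ := by
    intro y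
    obtain ⟨w, hw⟩ := (exact_extConnecting_extPrecomp M hT 0 y).1 (Subsingleton.elim _ _)
    exact ⟨extZeroEquiv M _ w, by simpa [δ] using hw⟩
  have hker (φ : T.X₁ →ₗ[R] M) :
      δ φ = 0 ↔ φ ∈ LinearMap.range (LinearMap.lcomp R M T.f.hom) := by
    refine (exact_extPrecomp_extConnecting M hT 0 _).trans ?_
    refine (extZeroEquiv M T.X₂).symm.surjective.exists.trans (exists_congr fun w => ?_)
    rw [← extZeroEquiv_symm_comp]
    exact (extZeroEquiv M T.X₁).symm.injective.eq_iff
  change L (ModuleCat.of R (Ext.{u} T.X₃ M 1)) ↔ _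
  rw [localizing_iff (L := L), hδ.forall]
  refine forall_congr' fun φ => exists_congr fun J => and_congr_right fun _ =>
    forall₂_congr fun a _ => ?_
  rw [← map_smul, Submodule.mem_bot, hker]

/-- For a short exact sequence `0 → A → B → C → 0` with `B` free, `Ext^1(C, M)` is in `L` if and
only if the cokernel of `Hom(B, M) → Hom(A, M)` is in `L`. -/
lemma extClass_one_iff [IsLocalizingSubcategory L] {A B C : Type u} [AddCommGroup A] [Module R A]
    [AddCommGroup B] [Module R B] [AddCommGroup C] [Module R C] {f : A →ₗ[R] B} {g : B →ₗ[R] C}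
    [Module.Free R B] (hf : Function.Injective f) (hg : Function.Surjective g)
    (h : Function.Exact f g) : extClass L M 1 (ModuleCat.of R C) ↔
      ∀ φ : A →ₗ[R] M, IsTorsionMod L (LinearMap.range (LinearMap.lcomp R M f)) φ := by
  have hT := ModuleCat.shortComplex_shortExact
    (ShortComplex.moduleCatMk f g h.linearMap_comp_eq_zero) h hf hg
  have : Subsingleton (Ext.{u} (ShortComplex.moduleCatMk f g h.linearMap_comp_eq_zero).X₂ M 1) :=
    ext_succ_subsingleton M B 0
  exact extClass_one_iff_of_shortExact M hT

end ExtClass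

/-! ### Koszul cohomology versus Ext -/

namespace Koszul

open IsDeltaClass

variable {R : Type u} [CommRing R] {n : ℕ} {L : ObjectProperty (ModuleCat.{u} R)}
  [IsLocalizingSubcategory L] (x : Fin n → R) (M : ModuleCat.{u} R)

lemma cohomology_zero_iff_ext :
    L (cohomology x M 0) ↔ extClass L M 0 (ModuleCat.of R (coker x 0)) := by
  rw [cohomology_zero_iff (L := L), extClass_zero_iff, localizing_iff (L := L)]
  constructor
  · intro h ψ
    obtain ⟨J, hJ, hJψ⟩ := h (ψ ∘ₗ (LinearMap.range (d x 0)).mkQ) (by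
      rw [LinearMap.comp_assoc, (LinearMap.exact_map_mkQ_range _).linearMap_comp_eq_zero,
        LinearMap.comp_zero])
    refine ⟨J, hJ, fun a ha => Submodule.linearMap_qext _ ?_⟩
    exact hJψ a ha
  · intro h φ hφ
    obtain ⟨J, hJ, hJψ⟩ := h ((LinearMap.range (d x 0)).liftQ φ
      (LinearMap.range_le_ker_iff.2 hφ))
    refine ⟨J, hJ, fun a ha => ?_⟩
    have := congrArg (fun ψ => ψ ∘ₗ (LinearMap.range (d x 0)).mkQ) (hJψ a ha)
    rw [LinearMap.smul_comp, Submodule.liftQ_mkQ, LinearMap.zero_comp] at this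
    exact this

lemma extClass_one_coker_iff (q : ℕ) : extClass L M 1 (ModuleCat.of R (coker x q)) ↔
    ∀ φ : LinearMap.range (d x q) →ₗ[R] M,
      IsTorsionMod L (LinearMap.range (LinearMap.lcomp R M (LinearMap.range (d x q)).subtype)) φ :=
  extClass_one_iff M (Submodule.subtype_injective _) (Submodule.mkQ_surjective _)
    (exact_subtype_mkQ _)

/-- A map φ on B_q gives the cocycle φ ∘ d; writing a multiple of it as a coboundary is the same as
extending that multiple of φ to K_q. -/
lemma extClass_one_coker (q : ℕ) (h : L (cohomology x M (q + 1))) :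
    extClass L M 1 (ModuleCat.of R (coker x q)) := by
  rw [cohomology_succ_iff (L := L)] at h
  rw [extClass_one_coker_iff]
  intro φ
  obtain ⟨J, hJ, hJφ⟩ := h (φ ∘ₗ (d x q).rangeRestrict) (by
    have : (d x q).rangeRestrict ∘ₗ d x (q + 1) = 0 :=
      LinearMap.ext fun z => Subtype.ext (LinearMap.congr_fun (d_comp_d x q) z)
    rw [LinearMap.comp_assoc, this, LinearMap.comp_zero])
  refine ⟨J, hJ, fun a ha => ?_⟩
  obtain ⟨w, hw⟩ := hJφ a ha
  refine ⟨w, LinearMap.ext ?_⟩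
  rintro ⟨_, z, rfl⟩
  exact LinearMap.congr_fun hw z

/-- A cocycle factors through Q_{q+1}. A multiple of it vanishes on the homology and so descends to
B_q, and a further multiple extends to K_q, which makes it a coboundary. -/
lemma cohomology_succ_of_ext (q : ℕ)
    (hH : extClass L M 0 (ModuleCat.of R (homologySucc x q)))
    (hQ : extClass L M 1 (ModuleCat.of R (coker x q))) : L (cohomology x M (q + 1)) := by
  rw [extClass_one_coker_iff] at hQ
  rw [extClass_zero_iff, localizing_iff (L := L)] at hH
  rw [cohomology_succ_iff (L := L)]
  intro φ hφ
  let ψ : coker x (q + 1) →ₗ[R] M :=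
    (LinearMap.range (d x (q + 1))).liftQ φ (LinearMap.range_le_ker_iff.2 hφ)
  obtain ⟨J, hJ, hJφ⟩ := hH (ψ ∘ₗ (homologySucc x q).subtype)
  refine isTorsionMod_of_smul hJ fun a ha => ?_
  let c := cokerToBoundaries (K := fun q => Idx n q → R) (d x) (d_comp_d x) q
  have hc : Function.Surjective c := cokerToBoundaries_surjective _ _ q
  have hker : LinearMap.ker c ≤ LinearMap.ker (a • ψ) := fun z hz =>
    LinearMap.congr_fun (hJφ a ha) ⟨z, hz⟩
  let χ : LinearMap.range (d x q) →ₗ[R] M :=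
    (LinearMap.ker c).liftQ (a • ψ) hker ∘ₗ (c.quotKerEquivOfSurjective hc).symm.toLinearMap
  have hχ (z : Idx n (q + 1) → R) : χ ((d x q).rangeRestrict z) = a • φ z := by
    have : (c.quotKerEquivOfSurjective hc).symm ((d x q).rangeRestrict z) =
        Submodule.Quotient.mk (Submodule.Quotient.mk z) := by
      rw [LinearEquiv.symm_apply_eq]
      rfl
    change (LinearMap.ker c).liftQ (a • ψ) hker ((c.quotKerEquivOfSurjective hc).symm _) = _
    rw [this]
    rfl
  obtain ⟨J', hJ', hJχ⟩ := hQ χ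
  refine ⟨J', hJ', fun b hb => ?_⟩
  obtain ⟨w, hw⟩ := hJχ b hb
  refine ⟨w, LinearMap.ext fun z => ?_⟩
  have := LinearMap.congr_fun hw ((d x q).rangeRestrict z)
  rw [LinearMap.smul_apply, hχ] at this
  exact this

variable [IsNoetherianRing R]

/-- The modules `Ext^i(N, M)`, for `N` finitely generated and killed by `(x)`, lie in `L` if and
only if the Koszul cohomology modules `H^i(K(x), M)` do. -/
theorem cohomology_iff_ext {I : Ideal R} (hx : Ideal.span (Set.range x) = I) :
    (∀ i, L (cohomology x M i)) ↔ ∀ (i : ℕ) (N : Type u) [AddCommGroup N] [Module R N]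
      [Module.Finite R N], I ≤ Module.annihilator R N → extClass L M i (ModuleCat.of R N) := by
  subst hx
  obtain ⟨e⟩ := exists_homology_zero_equiv x
  constructor
  · intro h
    exact (isDeltaClass_ext M).of_finite_of_coker (K := fun q => Idx n q → R) (d x) (d_comp_d x) e
      (le_annihilator_homology x) ((cohomology_zero_iff_ext x M).1 (h 0))
      (fun q => extClass_one_coker x M q (h (q + 1)))
  · intro h
    have h0 (j : ℕ) : extClass L M j (ModuleCat.of R (coker x 0)) :=
      h j _ (by rw [e.annihilator_eq, Ideal.annihilator_quotient])
    have hH (q j : ℕ) : extClass L M j (ModuleCat.of R (homologySucc x q)) :=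
      h j _ (le_annihilator_homology x q)
    intro i
    cases i with
    | zero => exact (cohomology_zero_iff_ext x M).2 (h0 0)
    | succ q =>
      exact cohomology_succ_of_ext x M q (hH q 0)
        ((isDeltaClass_ext M).coker_of_homology (K := fun q => Idx n q → R) (d x) (d_comp_d x)
          h0 hH q 0)

end Koszul

/-! ### Self-duality of the Koszul complex -/

namespace Koszul

open TensorProduct

section Total

variable {R : Type u} [CommRing R] {n : ℕ} (x : Fin n → R) (M : Type u) [AddCommGroup M]
  [Module R M]

/-- The total Koszul differential on functions from the subsets of `Fin n` to `M`. -/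
def totalD : (Finset (Fin n) → M) →ₗ[R] (Finset (Fin n) → M) where
  toFun f t := ∑ i : Fin n, if i ∉ t then (sign R t i * x i) • f (insert i t) else 0
  map_add' f g := by
    ext t
    simp only [Pi.add_apply, ← Finset.sum_add_distrib]
    refine Finset.sum_congr rfl fun i _ => ?_
    split_ifs <;> simp
  map_smul' r f := by
    ext t
    simp only [Pi.smul_apply, RingHom.id_apply, Finset.smul_sum]
    refine Finset.sum_congr rfl fun i _ => ?_
    split_ifs
    · simp
    · rw [smul_comm]

/-- The total Koszul codifferential on functions from the subsets of `Fin n` to `M`. -/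
def totalCoD : (Finset (Fin n) → M) →ₗ[R] (Finset (Fin n) → M) where
  toFun f t := ∑ i : Fin n, if i ∈ t then (sign R (t.erase i) i * x i) • f (t.erase i) else 0
  map_add' f g := by
    ext t
    simp only [Pi.add_apply, ← Finset.sum_add_distrib]
    refine Finset.sum_congr rfl fun i _ => ?_
    split_ifs <;> simp
  map_smul' r f := by
    ext t
    simp only [Pi.smul_apply, RingHom.id_apply, Finset.smul_sum]
    refine Finset.sum_congr rfl fun i _ => ?_
    split_ifs
    · rw [smul_comm]
    · simp

lemma totalD_apply (f : Finset (Fin n) → M) (t : Finset (Fin n)) : totalD x M f t =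
    ∑ i : Fin n, if i ∉ t then (sign R t i * x i) • f (insert i t) else 0 := rfl

lemma totalCoD_apply (f : Finset (Fin n) → M) (t : Finset (Fin n)) : totalCoD x M f t =
    ∑ i : Fin n, if i ∈ t then (sign R (t.erase i) i * x i) • f (t.erase i) else 0 := rfl

/-- The functions supported on the subsets with `p` elements. -/
def supportedOn (R : Type u) [CommRing R] [Module R M] (p : ℕ) :
    Submodule R (Finset (Fin n) → M) where
  carrier := {f | ∀ s, s.card ≠ p → f s = 0}
  add_mem' hf hg s hs := by simp [hf s hs, hg s hs]
  zero_mem' _ _ := rfl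
  smul_mem' r f hf s hs := by simp [hf s hs]

variable {M}

lemma neg_one_pow_sum_mul_self (t : Finset (Fin n)) :
    ((-1 : R) ^ (∑ j ∈ t, (j : ℕ))) * (-1) ^ (∑ j ∈ t, (j : ℕ)) = 1 := by
  rw [← pow_add, ← two_mul, pow_mul]
  simp

variable (R M) in
/-- The self-duality of the total Koszul complex, up to signs the map induced by complements. -/
def complementEquiv : (Finset (Fin n) → M) ≃ₗ[R] (Finset (Fin n) → M) where
  toFun f t := ((-1 : R) ^ (∑ j ∈ t, (j : ℕ))) • f tᶜ
  invFun f t := ((-1 : R) ^ (∑ j ∈ tᶜ, (j : ℕ))) • f tᶜ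
  map_add' f g := by ext t; simp
  map_smul' r f := by ext t; exact smul_comm _ _ _
  left_inv f := by
    ext t
    simp only [compl_compl, smul_smul, neg_one_pow_sum_mul_self, one_smul]
  right_inv f := by
    ext t
    simp only [compl_compl, smul_smul, neg_one_pow_sum_mul_self, one_smul]

lemma complementEquiv_apply (f : Finset (Fin n) → M) (t : Finset (Fin n)) :
    complementEquiv R M f t = ((-1 : R) ^ (∑ j ∈ t, (j : ℕ))) • f tᶜ := rfl

/-- The i indices below i are split between t and its complement. This is why the twist (-1)^(sum of
t) makes complementation compatible with the differentials. -/
lemma sign_mul_sign_compl {t : Finset (Fin n)} {i : Fin n} :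
    sign R t i * (-1) ^ (i : ℕ) = sign R (tᶜ.erase i) i := by
  have h : (t.filter (· < i)).card + ((tᶜ.erase i).filter (· < i)).card = (i : ℕ) := by
    rw [← Finset.card_union_of_disjoint]
    · have : t.filter (· < i) ∪ (tᶜ.erase i).filter (· < i) = Finset.Iio i := by
        ext j
        simp only [Finset.mem_union, Finset.mem_filter, Finset.mem_erase, Finset.mem_compl,
          Finset.mem_Iio]
        constructor
        · rintro (h | h) <;> exact h.2
        · intro h
          by_cases hj : j ∈ t
          · exact Or.inl ⟨hj, h⟩
          · exact Or.inr ⟨⟨h.ne, hj⟩, h⟩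
      rw [this, Fin.card_Iio]
    · rw [Finset.disjoint_left]
      intro j hj hj'
      simp only [Finset.mem_filter, Finset.mem_erase, Finset.mem_compl] at hj hj'
      exact hj'.1.2 hj.1
  have h' := sign_mul_self (R := R) t i
  calc sign R t i * (-1) ^ (i : ℕ) = sign R t i * (sign R t i * sign R (tᶜ.erase i) i) := by
        rw [← h, pow_add, sign, sign]
    _ = sign R (tᶜ.erase i) i := by rw [← mul_assoc, h', one_mul]

lemma totalD_complementEquiv (f : Finset (Fin n) → M) :
    totalD x M (complementEquiv R M f) = complementEquiv R M (totalCoD x M f) := by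
  ext t
  rw [complementEquiv_apply, totalD_apply, totalCoD_apply, Finset.smul_sum]
  refine Finset.sum_congr rfl fun i _ => ?_
  by_cases hi : i ∈ t
  · simp [hi]
  · rw [if_pos hi, if_pos (Finset.mem_compl.2 hi), complementEquiv_apply, smul_smul, smul_smul,
      Finset.sum_insert hi, Finset.compl_insert, ← sign_mul_sign_compl, pow_add]
    congr 1
    ring

lemma complementEquiv_mem_supportedOn {p q : ℕ} (h : p + q = n) (f : Finset (Fin n) → M) :
    complementEquiv R M f ∈ supportedOn M R p ↔ f ∈ supportedOn M R q := by
  have hc (t : Finset (Fin n)) : tᶜ.card + t.card = n := by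
    simp
  constructor
  · intro hf s hs
    have := hf sᶜ (by have := hc s; omega)
    rw [complementEquiv_apply, compl_compl] at this
    have h' := congrArg (fun z => ((-1 : R) ^ (∑ j ∈ sᶜ, (j : ℕ))) • z) this
    simpa only [smul_smul, neg_one_pow_sum_mul_self, one_smul, smul_zero] using h'
  · intro hf t ht
    rw [complementEquiv_apply, hf tᶜ (by have := hc t; omega), smul_zero]

lemma totalD_apply_eq_zero {p : ℕ} {f : Finset (Fin n) → M} (hf : f ∈ supportedOn M R p)
    {t : Finset (Fin n)} (ht : t.card + 1 ≠ p) : totalD x M f t = 0 := by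
  rw [totalD_apply]
  refine Finset.sum_eq_zero fun i _ => ?_
  split_ifs with hi
  · rfl
  · rw [hf _ (by rwa [Finset.card_insert_of_notMem hi]), smul_zero]

lemma totalCoD_apply_eq_zero {p : ℕ} {f : Finset (Fin n) → M} (hf : f ∈ supportedOn M R p)
    {t : Finset (Fin n)} (ht : t.card ≠ p + 1) : totalCoD x M f t = 0 := by
  rw [totalCoD_apply]
  refine Finset.sum_eq_zero fun i _ => ?_
  split_ifs with hi
  · rw [hf _ (by
      rw [Finset.card_erase_of_mem hi]
      have := Finset.card_pos.2 ⟨i, hi⟩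
      omega), smul_zero]
  · rfl

variable (M) in
/-- Extension by zero of functions on the subsets with `p` elements. -/
def extendZero (R : Type u) [CommRing R] [Module R M] (p : ℕ) :
    (Idx n p → M) →ₗ[R] (Finset (Fin n) → M) where
  toFun f s := if h : s.card = p then f ⟨s, h⟩ else 0
  map_add' f g := by
    ext s
    simp only [Pi.add_apply]
    split_ifs <;> simp
  map_smul' r f := by
    ext s
    simp only [Pi.smul_apply, RingHom.id_apply]
    split_ifs <;> simp

lemma extendZero_apply {p : ℕ} (f : Idx n p → M) (s : Finset (Fin n)) :
    extendZero M R p f s = if h : s.card = p then f ⟨s, h⟩ else 0 := rfl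

lemma extendZero_injective (p : ℕ) : Function.Injective (extendZero (n := n) M R p) := by
  intro f g h
  ext s
  have := congrFun h s.1
  simpa only [extendZero_apply, dif_pos s.2] using this

lemma range_extendZero (p : ℕ) :
    LinearMap.range (extendZero (n := n) M R p) = supportedOn M R p := by
  ext f
  constructor
  · rintro ⟨f, rfl⟩ s hs
    rw [extendZero_apply, dif_neg hs]
  · intro hf
    refine ⟨fun s => f s.1, funext fun s => ?_⟩
    rw [extendZero_apply]
    split_ifs with h
    · rfl
    · exact (hf s h).symm

/-- The differential is homogeneous, so only the component of w on subsets with p + 1 elements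
contributes. Boundaries in the total complex thus agree with boundaries in each degree. -/
lemma exists_totalD_eq {p : ℕ} {f w : Finset (Fin n) → M} (hf : f ∈ supportedOn M R p)
    (hw : totalD x M w = f) :
    ∃ w' : Idx n (p + 1) → M, totalD x M (extendZero M R (p + 1) w') = f := by
  refine ⟨fun s => w s.1, funext fun t => ?_⟩
  by_cases ht : t.card = p
  · rw [← hw, totalD_apply, totalD_apply]
    refine Finset.sum_congr rfl fun i _ => ?_
    split_ifs with hi
    · rfl
    · rw [extendZero_apply, dif_pos (by rw [Finset.card_insert_of_notMem hi, ht])]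
  · rw [hf t ht]
    refine totalD_apply_eq_zero x (p := p + 1) ?_ (by omega)
    rw [← range_extendZero]
    exact ⟨_, rfl⟩

lemma totalCoD_apply_empty (f : Finset (Fin n) → M) : totalCoD x M f ∅ = 0 := by
  rw [totalCoD_apply]
  exact Finset.sum_eq_zero fun i _ => if_neg (Finset.notMem_empty i)

lemma exists_totalCoD_eq {p : ℕ} {f w : Finset (Fin n) → M} (hf : f ∈ supportedOn M R (p + 1))
    (hw : totalCoD x M w = f) :
    ∃ w' : Idx n p → M, totalCoD x M (extendZero M R p w') = f := by
  refine ⟨fun s => w s.1, funext fun t => ?_⟩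
  by_cases ht : t.card = p + 1
  · rw [← hw, totalCoD_apply, totalCoD_apply]
    refine Finset.sum_congr rfl fun i _ => ?_
    split_ifs with hi
    · rw [extendZero_apply, dif_pos (by rw [Finset.card_erase_of_mem hi, ht]; rfl)]
    · rfl
  · rw [hf t ht]
    refine totalCoD_apply_eq_zero x (p := p) ?_ ht
    rw [← range_extendZero]
    exact ⟨_, rfl⟩

variable (M) in
/-- The identification of `K_p ⊗ M` with the functions supported on the `p`-element subsets. -/
noncomputable def tensorEmbedding (R : Type u) [CommRing R] [Module R M] (p : ℕ) :
    (Idx n p → R) ⊗[R] M →ₗ[R] (Finset (Fin n) → M) :=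
  extendZero M R p ∘ₗ ((TensorProduct.comm R (Idx n p → R) M).trans
    (TensorProduct.piScalarRight R R M (Idx n p))).toLinearMap

lemma tensorEmbedding_tmul {p : ℕ} (f : Idx n p → R) (m : M) (s : Finset (Fin n)) :
    tensorEmbedding M R p (f ⊗ₜ m) s = if h : s.card = p then f ⟨s, h⟩ • m else 0 := by
  simp [tensorEmbedding, extendZero_apply]

lemma tensorEmbedding_injective (p : ℕ) :
    Function.Injective (tensorEmbedding (n := n) M R p) :=
  (extendZero_injective (R := R) (M := M) p).comp (LinearEquiv.injective _)

lemma range_tensorEmbedding (p : ℕ) :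
    LinearMap.range (tensorEmbedding (n := n) M R p) = supportedOn M R p := by
  rw [tensorEmbedding, LinearMap.range_comp_of_range_eq_top _ (LinearEquiv.range _),
    range_extendZero]

lemma totalD_tensorEmbedding (p : ℕ) (z : (Idx n (p + 1) → R) ⊗[R] M) :
    totalD x M (tensorEmbedding M R (p + 1) z) =
      tensorEmbedding M R p ((d x p).rTensor M z) := by
  induction z with
  | zero => simp
  | add z w hz hw => simp only [map_add, hz, hw]
  | tmul f m =>
    ext t
    rw [LinearMap.rTensor_tmul, tensorEmbedding_tmul]
    split_ifs with ht
    · change _ = (∑ i : Fin n, if hi : i ∉ t then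
        sign R t i * x i * f (Idx.insert ⟨t, ht⟩ i hi) else 0) • m
      rw [totalD_apply, Finset.sum_smul]
      refine Finset.sum_congr rfl fun i _ => ?_
      by_cases hi : i ∈ t
      · simp [hi]
      · rw [if_pos hi, dif_pos hi, tensorEmbedding_tmul,
          dif_pos (by rw [Finset.card_insert_of_notMem hi, ht]), smul_smul]
        rfl
    · refine totalD_apply_eq_zero x (p := p + 1) ?_ (by omega)
      rw [← range_tensorEmbedding]
      exact ⟨_, rfl⟩

variable (M) in
/-- The identification of `Hom(K_p, M)` with the functions supported on the `p`-element
subsets. -/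
def homEmbedding (R : Type u) [CommRing R] [Module R M] (p : ℕ) :
    ((Idx n p → R) →ₗ[R] M) →ₗ[R] (Finset (Fin n) → M) :=
  extendZero M R p ∘ₗ (LinearEquiv.piRing R M (Idx n p) R).toLinearMap

lemma homEmbedding_apply {p : ℕ} (φ : (Idx n p → R) →ₗ[R] M) (s : Finset (Fin n)) :
    homEmbedding M R p φ s = if h : s.card = p then φ (Pi.single ⟨s, h⟩ 1) else 0 := by
  simp [homEmbedding, extendZero_apply]

lemma homEmbedding_injective (p : ℕ) : Function.Injective (homEmbedding (n := n) M R p) :=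
  (extendZero_injective (R := R) (M := M) p).comp (LinearEquiv.injective _)

lemma range_homEmbedding (p : ℕ) :
    LinearMap.range (homEmbedding (n := n) M R p) = supportedOn M R p := by
  rw [homEmbedding, LinearMap.range_comp_of_range_eq_top _ (LinearEquiv.range _),
    range_extendZero]

lemma d_single (p : ℕ) (s : Idx n (p + 1)) : d x p (Pi.single s 1) =
    ∑ i : Fin n, if hi : i ∈ s.1 then (sign R (s.1.erase i) i * x i) •
      Pi.single (⟨s.1.erase i, by rw [Finset.card_erase_of_mem hi, s.2]; rfl⟩ : Idx n p) (1 : R)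
    else 0 := by
  ext t
  rw [Finset.sum_apply]
  change (∑ i : Fin n, if hi : i ∉ t.1 then
    sign R t.1 i * x i * (Pi.single s 1 : Idx n (p + 1) → R) (t.insert i hi) else 0) = _
  refine Finset.sum_congr rfl fun i _ => ?_
  by_cases h : i ∉ t.1 ∧ insert i t.1 = s.1
  · obtain ⟨hi, h⟩ := h
    have his : i ∈ s.1 := h ▸ Finset.mem_insert_self i t.1
    have hs : s.1.erase i = t.1 := by rw [← h, Finset.erase_insert hi]
    have h1 : t.insert i hi = s := Subtype.ext h
    rw [dif_pos hi, dif_pos his, h1, Pi.single_eq_same, Pi.smul_apply]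
    simp only [hs]
    rw [Pi.single_eq_same, smul_eq_mul]
  · trans 0
    · split_ifs with hi
      · rfl
      · rw [Pi.single_eq_of_ne, mul_zero]
        exact fun h' => h ⟨hi, congrArg Subtype.val h'⟩
    · split_ifs with hi
      · rw [Pi.smul_apply, Pi.single_eq_of_ne, smul_zero]
        rintro rfl
        exact h ⟨Finset.notMem_erase i s.1, Finset.insert_erase hi⟩
      · rfl

lemma totalCoD_homEmbedding (p : ℕ) (φ : (Idx n p → R) →ₗ[R] M) :
    totalCoD x M (homEmbedding M R p φ) = homEmbedding M R (p + 1) (φ ∘ₗ d x p) := by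
  ext t
  rw [homEmbedding_apply]
  split_ifs with ht
  · rw [LinearMap.comp_apply, d_single, map_sum, totalCoD_apply]
    refine Finset.sum_congr rfl fun i _ => ?_
    split_ifs with hi
    · rw [map_smul, homEmbedding_apply, dif_pos (by rw [Finset.card_erase_of_mem hi, ht]; rfl)]
    · rw [map_zero]
  · refine totalCoD_apply_eq_zero x (p := p) ?_ ht
    rw [← range_homEmbedding]
    exact ⟨_, rfl⟩

end Total

/-! ### Transfer between Koszul homology and cohomology -/

section Duality

variable {R : Type u} [CommRing R] {n : ℕ} {L : ObjectProperty (ModuleCat.{u} R)}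
  [IsLocalizingSubcategory L] (x : Fin n → R) (M : ModuleCat.{u} R)

lemma mem_range_rTensor_iff {p : ℕ} (z : (Idx n p → R) ⊗[R] M) :
    z ∈ LinearMap.range ((d x p).rTensor M) ↔
      tensorEmbedding M R p z ∈ LinearMap.range (totalD x M) := by
  constructor
  · rintro ⟨w, rfl⟩
    exact ⟨_, totalD_tensorEmbedding x p w⟩
  · rintro ⟨w, hw⟩
    have hz : tensorEmbedding M R p z ∈ supportedOn M R p := by
      rw [← range_tensorEmbedding]
      exact ⟨z, rfl⟩
    obtain ⟨w, hw⟩ := exists_totalD_eq x hz hw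
    obtain ⟨w, hw'⟩ : extendZero M R (p + 1) w ∈ LinearMap.range (tensorEmbedding M R (p + 1)) := by
      rw [range_tensorEmbedding, ← range_extendZero]
      exact ⟨w, rfl⟩
    refine ⟨w, tensorEmbedding_injective p ?_⟩
    rw [← totalD_tensorEmbedding, hw', hw]

lemma mem_range_lcomp_iff {p : ℕ} (φ : (Idx n (p + 1) → R) →ₗ[R] M) :
    φ ∈ LinearMap.range (LinearMap.lcomp R M (d x p)) ↔
      homEmbedding M R (p + 1) φ ∈ LinearMap.range (totalCoD x M) := by
  constructor
  · rintro ⟨w, rfl⟩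
    exact ⟨_, totalCoD_homEmbedding x p w⟩
  · rintro ⟨w, hw⟩
    have hz : homEmbedding M R (p + 1) φ ∈ supportedOn M R (p + 1) := by
      rw [← range_homEmbedding]
      exact ⟨φ, rfl⟩
    obtain ⟨w, hw⟩ := exists_totalCoD_eq x hz hw
    obtain ⟨w, hw'⟩ : extendZero M R p w ∈ LinearMap.range (homEmbedding M R p) := by
      rw [range_homEmbedding, ← range_extendZero]
      exact ⟨w, rfl⟩
    refine ⟨w, homEmbedding_injective (p + 1) ?_⟩
    rw [LinearMap.lcomp_apply', ← totalCoD_homEmbedding, hw', hw]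

lemma homology_iff_total (p : ℕ) : L (homology x M p) ↔
    ∀ f ∈ supportedOn (n := n) M R p, totalD x M f = 0 →
      IsTorsionMod L (LinearMap.range (totalD x M)) f := by
  rw [← range_tensorEmbedding]
  have key (z : (Idx n p → R) ⊗[R] M) : IsTorsionMod L (LinearMap.range ((d x p).rTensor M)) z ↔
      IsTorsionMod L (LinearMap.range (totalD x M)) (tensorEmbedding M R p z) := by
    simp only [IsTorsionMod, mem_range_rTensor_iff, map_smul]
  have h : L (homology x M p) ↔ ∀ z, totalD x M (tensorEmbedding M R p z) = 0 →
      IsTorsionMod L (LinearMap.range (totalD x M)) (tensorEmbedding M R p z) := by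
    cases p with
    | zero =>
      refine (homology_zero_iff x M).trans (forall_congr' fun z => (key z).trans ?_)
      -- The cycle condition is automatic in degree 0, since no subset has cardinality -1.
      refine ⟨fun h _ => h, fun h => h (funext fun t => ?_)⟩
      refine totalD_apply_eq_zero x (p := 0) ?_ (Nat.succ_ne_zero _)
      rw [← range_tensorEmbedding]
      exact ⟨z, rfl⟩
    | succ p =>
      refine (homology_succ_iff x M p).trans (forall_congr' fun z => imp_congr ?_ (key z))
      rw [totalD_tensorEmbedding]
      exact (map_eq_zero_iff _ (tensorEmbedding_injective p)).symm
  rw [h]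
  exact ⟨by rintro h _ ⟨z, rfl⟩; exact h z, fun h z => h _ ⟨z, rfl⟩⟩

lemma cohomology_iff_total (p : ℕ) : L (cohomology x M p) ↔
    ∀ f ∈ supportedOn (n := n) M R p, totalCoD x M f = 0 →
      IsTorsionMod L (LinearMap.range (totalCoD x M)) f := by
  rw [← range_homEmbedding]
  have hcyc (φ : (Idx n p → R) →ₗ[R] M) :
      φ ∘ₗ d x p = 0 ↔ totalCoD x M (homEmbedding M R p φ) = 0 := by
    rw [totalCoD_homEmbedding]
    exact (map_eq_zero_iff _ (homEmbedding_injective (p + 1))).symm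
  have h : L (cohomology x M p) ↔ ∀ φ, totalCoD x M (homEmbedding M R p φ) = 0 →
      IsTorsionMod L (LinearMap.range (totalCoD x M)) (homEmbedding M R p φ) := by
    cases p with
    | zero =>
      refine (cohomology_zero_iff x M).trans (forall_congr' fun φ => imp_congr (hcyc φ) ?_)
      simp only [IsTorsionMod, ← map_smul, Submodule.mem_bot]
      refine exists_congr fun J => and_congr_right fun _ => forall₂_congr fun a _ => ?_
      rw [← map_eq_zero_iff _ (homEmbedding_injective (n := n) (M := M) (R := R) 0)]
      refine ⟨fun h => h ▸ Submodule.zero_mem _, ?_⟩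
      -- A total coboundary supported in degree 0 is zero: it vanishes at the empty set because
      -- there is no element to erase.
      rintro ⟨w, hw⟩
      rw [← hw]
      ext t
      rcases t.eq_empty_or_nonempty with rfl | ht
      · exact totalCoD_apply_empty x w
      · rw [hw, homEmbedding_apply, dif_neg (Finset.card_pos.2 ht).ne']
        rfl
    | succ p =>
      refine (cohomology_succ_iff x M p).trans (forall_congr' fun φ => imp_congr (hcyc φ) ?_)
      simp only [IsTorsionMod, mem_range_lcomp_iff, map_smul]
  rw [h]
  exact ⟨by rintro h _ ⟨z, rfl⟩; exact h z, fun h z => h _ ⟨z, rfl⟩⟩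

/-- Self-duality of the Koszul complex. -/
lemma homology_iff_cohomology_of_add_eq {p q : ℕ} (hpq : p + q = n) :
    L (homology x M p) ↔ L (cohomology x M q) := by
  rw [homology_iff_total (L := L), cohomology_iff_total (L := L), (complementEquiv R M).surjective.forall]
  refine forall_congr' fun f => imp_congr (complementEquiv_mem_supportedOn hpq f)
    (imp_congr ?_ ?_)
  · rw [totalD_complementEquiv, LinearEquiv.map_eq_zero_iff]
  · simp only [IsTorsionMod, ← map_smul]
    refine exists_congr fun J => and_congr_right fun _ => forall₂_congr fun a _ => ?_
    simp only [LinearMap.mem_range]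
    rw [(complementEquiv R M).surjective.exists]
    simp only [totalD_complementEquiv, EmbeddingLike.apply_eq_iff_eq]

lemma supportedOn_eq_bot {p : ℕ} (hp : n < p) : supportedOn (n := n) M R p = ⊥ := by
  rw [eq_bot_iff]
  intro f hf
  ext s
  refine hf s fun h => ?_
  have := s.card_le_univ
  rw [Fintype.card_fin] at this
  omega

/-- Degrees p and n - p are exchanged by duality, and both sides vanish above degree n. -/
lemma forall_homology_iff_forall_cohomology :
    (∀ i, L (homology x M i)) ↔ ∀ i, L (cohomology x M i) := by
  constructor
  · intro h i
    by_cases hi : i ≤ n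
    · exact (homology_iff_cohomology_of_add_eq x M (Nat.sub_add_cancel hi)).1 (h _)
    · rw [cohomology_iff_total (L := L), supportedOn_eq_bot M (by omega)]
      rintro f rfl -
      exact isTorsionMod_of_mem (Submodule.zero_mem _)
  · intro h i
    by_cases hi : i ≤ n
    · exact (homology_iff_cohomology_of_add_eq x M (Nat.add_sub_cancel' hi)).2 (h _)
    · rw [homology_iff_total (L := L), supportedOn_eq_bot M (by omega)]
      rintro f rfl -
      exact isTorsionMod_of_mem (Submodule.zero_mem _)

end Duality

end Koszul

/-! ### Assembly of the equivalences -/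

theorem mainTheorem2 {R : Type u} [CommRing R] [IsNoetherianRing R]
    (S L : ObjectProperty (ModuleCat.{u} R)) [S.IsSerreClass] [IsLocalizingSubcategory L]
    -- a finite system of generators of each ideal, used to form its Koszul complex
    (n : Ideal R → ℕ) (x : (I : Ideal R) → Fin (n I) → R)
    (hx : ∀ I : Ideal R, Ideal.span (Set.range (x I)) = I)
    (M : ModuleCat.{u} R) :
    List.TFAE [
      ∀ (p : Ideal R) [p.IsPrime], S (ModuleCat.of R (R ⧸ p)) →
        ∀ i : ℕ, L (((Tor (ModuleCat.{u} R) i).obj (ModuleCat.of R p.ResidueField)).obj M),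
      ∀ N : ModuleCat.{u} R, S N → ∀ i : ℕ, L (((Tor (ModuleCat.{u} R) i).obj N).obj M),
      ∀ I : Ideal R, S (ModuleCat.of R (R ⧸ I)) →
        ∀ i : ℕ, L (((Tor (ModuleCat.{u} R) i).obj (ModuleCat.of R (R ⧸ I))).obj M),
      ∀ I : Ideal R, S (ModuleCat.of R (R ⧸ I)) → ∀ i : ℕ, L (Koszul.homology (x I) M i),
      ∀ I : Ideal R, S (ModuleCat.of R (R ⧸ I)) →
        ∀ i : ℕ, L (ModuleCat.of R (Abelian.Ext.{u} (ModuleCat.of R (R ⧸ I)) M i)),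
      ∀ I : Ideal R, S (ModuleCat.of R (R ⧸ I)) → ∀ i : ℕ, L (Koszul.cohomology (x I) M i)] := by
  have tor_quotient (h : ∀ I : Ideal R, S (ModuleCat.of R (R ⧸ I)) → ∀ i : ℕ,
      torClass L M i (ModuleCat.of R (R ⧸ I))) (i : ℕ) (p : Ideal R) (_ : p.IsPrime)
      (hp : S (ModuleCat.of R (R ⧸ p))) : torClass L M i (ModuleCat.of R (R ⧸ p)) := h p hp i
  tfae_have 2 → 3 := fun h I hI i => h _ hI i
  tfae_have 3 → 2 := fun h N hN i => torClass_of_serre (tor_quotient h i) N hN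
  tfae_have 3 → 1 := fun h p _ hp i => torClass_residueField (tor_quotient h i) p hp
  tfae_have 1 → 2 := fun h N hN i => torClass_of_serre
    (fun p hp hS => torClass_prime_of_residueField h p hp hS i) N hN
  tfae_have 2 → 4 := fun h I hI => (Koszul.homology_iff_tor (x I) M (hx I)).2
    fun i N _ _ _ hN => h (ModuleCat.of R N) (serre_of_finite S hI hN) i
  tfae_have 4 → 3 := fun h I hI i => (Koszul.homology_iff_tor (x I) M (hx I)).1 (h I hI) i
    (R ⧸ I) (Ideal.annihilator_quotient (I := I)).ge
  tfae_have 4 ↔ 6 := forall₂_congr fun I _ =>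
    -- The only bridge between the Tor side and the Ext side.
    Koszul.forall_homology_iff_forall_cohomology (x I) M
  -- Ext does not turn directed unions of N into a direct limit, so only finitely generated N are
  -- used; those killed by I lie in `S`, and dévissage reduces them to prime quotients.
  tfae_have 5 → 6 := fun h I hI => (Koszul.cohomology_iff_ext (x I) M (hx I)).2
    fun i N _ _ _ hN => (isDeltaClass_ext M).of_serre_of_finite (fun p _ hp => h p hp i) N
      (serre_of_finite S hI hN)
  tfae_have 6 → 5 := fun h I hI i => (Koszul.cohomology_iff_ext (x I) M (hx I)).1 (h I hI) i
    (R ⧸ I) (Ideal.annihilator_quotient (I := I)).ge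
  tfae_finish
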